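/- Let $d\in\mathbb N$, $T>0$, and let $u_0$ be a Borel probability measure on $\mathbb{R}^d$ with compact support $S=\operatorname{supp}(u_0)$. For $t>0$ let $G_t(x)=(4\pi t)^{-d/2}e^{-\|x\|^2/(4t)}$, let $u(x,t)=\int_{\mathbb{R}^d}G_t(x-y)\,du_0(y)$ be the heat flow started from $u_0$, and let $s(x,t)=\nabla_x\log u(x,t)$ be its score function. Let $d(x,A)$ denote the Euclidean distance from $x$ to $A$. For every $x_T\in\mathbb{R}^d$ the problem $$\frac{dX_t}{dt}=-s(X_t,t),\quad t\in(0,T),\qquad X_T=x_T,$$ has a unique solution $(X_t)_{t\in(0,T]}$ (continuous on $(0,T]$ and differentiable on $(0,T)$), and the following hold. (i) For Lebesgue-almost every $x_T\in\mathbb{R}^d$, $$\liminf_{t\to0^+}d(X_t,S)=0.$$ (ii) Let $K=\operatorname{conv}(S)$. For every $x_T\in\mathbb{R}^d$, $$d(X_t,K)\le d(x_T,K)\,T^{-1/2}\sqrt t\qquad\text{for all }t\in(0,T].$$ (iii) Suppose that $u_0=\sum_{k=1}^N w_k\delta_{y_k}$ with $w_k>0$ and $y_k\in\mathbb{R}^d$.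 Then for Lebesgue-almost every $x_T\in\mathbb{R}^d$ there exist an index $i\in\{1,\dots,N\}$, depending on $x_T$, such that $\lim_{t\to0^+}X_t=y_i$, and a constant $C>0$, depending (for the given $u_0$) only on $x_T$ and $T$, such that $$\|X_t-y_i\|\le C\sqrt t\qquad\text{for all }t\in(0,T].$$ -/

import Mathlib

/-!
The heat flow of a probability measure on `ℝ^d`, its score function, and the
deterministic reverse-time (generation) flow driven by the score.
-/

open MeasureTheory Set Filter Topology

noncomputable section

/-- The Gaussian heat kernel `G_t(x) = (4 π t)^(-d/2) exp (-‖x‖² / (4 t))` on `ℝ^d`. -/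
def heatKernel {d : ℕ} (t : ℝ) (x : EuclideanSpace ℝ (Fin d)) : ℝ :=
  (4 * Real.pi * t) ^ (-(d : ℝ) / 2) * Real.exp (-‖x‖ ^ 2 / (4 * t))

/-- The heat flow `u(x, t) = (G_t * u₀)(x) = ∫ G_t(x - y) du₀(y)` started from the measure `u₀`. -/
def heatFlow {d : ℕ} (u₀ : Measure (EuclideanSpace ℝ (Fin d)))
    (x : EuclideanSpace ℝ (Fin d)) (t : ℝ) : ℝ :=
  ∫ y, heatKernel t (x - y) ∂u₀

/-- The score function `s(x, t) = ∇ₓ log u(x, t)` of the heat flow. -/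
def score {d : ℕ} (u₀ : Measure (EuclideanSpace ℝ (Fin d)))
    (x : EuclideanSpace ℝ (Fin d)) (t : ℝ) : EuclideanSpace ℝ (Fin d) :=
  gradient (fun z => Real.log (heatFlow u₀ z t)) x

/-- `X` solves `dX_t/dt = -s(X_t, t)` for `t ∈ (0, T)` with terminal value `X_T = x_T`,
continuously up to `t = T`. Only the values of `X` on `(0, T]` matter. -/
structure IsReverseFlow {d : ℕ} (u₀ : Measure (EuclideanSpace ℝ (Fin d))) (T : ℝ)
    (x_T : EuclideanSpace ℝ (Fin d)) (X : ℝ → EuclideanSpace ℝ (Fin d)) : Prop where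
  continuousOn : ContinuousOn X (Ioc 0 T)
  hasDerivAt : ∀ t ∈ Ioo 0 T, HasDerivAt X (-score u₀ (X t) t) t
  terminal : X T = x_T

end

/-!
In the coordinates `r = 1 / √t`, `Y = r X` the reverse-time equation becomes
`Y' = 𝔼[y | r y + G = Y]`, where `y` has law `u₀` and `G` is Gaussian (`score_eq`,
`hasDerivAt_sqrt_smul`). The limit `t → 0` is the limit `r → ∞`. The right-hand side,
`posteriorMean`, is bounded by the radius of the support and locally Lipschitz, so the equation
has a global flow for all real `r`; this gives well-posedness (`IsReverseFlow.eq_flow`).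

For (i), the flow transports the law of `s y + G` to the law of `r y + G` (`integral_flow_eq`). No
differentiability of the flow in the initial value is needed: for a Lipschitz observable `f`, the
function `F` sending a point at time `r` to the value of `f` at the endpoint of its trajectory is
Lipschitz, hence differentiable almost everywhere by Rademacher's theorem. Moving
the straight line `q ↦ q y + g` back to time `r` gives a curve with initial velocity
`y - 𝔼[y | r y + g]`, whose pairing with `DF (r y + g)` has mean zero. So the expectation of `f` at
the endpoint does not depend on the starting time. Applied to the truncated distance of `z / r` to
the support, this shows that the expected distance along the flow tends to zero, and Fatou's lemma
gives almost every trajectory a sequence of times along which it approaches the support.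

For (ii), `Y r - Y s` is `r - s` times an average of posterior means, hence `r - s` times a point of
the closed convex hull, so the displacement from the dilated hull does not grow
(`infDist_inv_smul_le`).

For (iii), by (i) almost every trajectory comes close to an atom `a` at some late `r`. Near the
ray `r a` the posterior mean is super-exponentially close to `a`, so the trajectory is trapped in a
cone around the ray and stays at bounded distance from it (`exists_trapping_time`), which in the
original coordinates is the rate `√t`.
-/

open scoped NNReal RealInnerProductSpace

/-! ### Global flows of bounded, locally Lipschitz vector fields -/

section GlobalFlow

variable {E : Type*} [NormedAddCommGroup E]

/-- A bounded time-dependent vector field that is continuous in time and Lipschitz in space,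
uniformly on compact time intervals. -/
structure IsBoundedField (V : ℝ → E → E) (R : ℝ) : Prop where
  norm_le : ∀ r z, ‖V r z‖ ≤ R
  continuous_time : ∀ z, Continuous (V · z)
  lipschitz : ∀ b : ℝ, ∃ K : ℝ≥0, ∀ r ∈ Icc (-b) b, LipschitzWith K (V r)

variable {V : ℝ → E → E} {R : ℝ}

theorem IsBoundedField.continuous_uncurry (hV : IsBoundedField V R) :
    Continuous (Function.uncurry V) := by
  refine continuous_iff_continuousAt.2 fun p => ?_
  obtain ⟨K, hK⟩ := hV.lipschitz (|p.1| + 1)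
  have h : ContinuousOn (Function.uncurry V) (Ioo (-(|p.1| + 1)) (|p.1| + 1) ×ˢ univ) :=
    continuousOn_prod_of_continuousOn_lipschitzOnWith' _ K
      (fun r hr => (hK r (Ioo_subset_Icc_self hr)).lipschitzOnWith)
      fun z _ => (hV.continuous_time z).continuousOn
  refine h.continuousAt (prod_mem_nhds (Ioo_mem_nhds ?_ ?_) univ_mem)
  · linarith [neg_abs_le p.1]
  · linarith [le_abs_self p.1]

theorem IsBoundedField.continuous_along (hV : IsBoundedField V R) {Y : ℝ → E}
    (hY : Continuous Y) : Continuous fun r => V r (Y r) :=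
  hV.continuous_uncurry.comp (continuous_id.prodMk hY)

/-- Reversing time turns a bounded field into a bounded field. -/
theorem IsBoundedField.reverse (hV : IsBoundedField V R) :
    IsBoundedField (fun r z => -V (-r) z) R where
  norm_le r z := by simpa using hV.norm_le (-r) z
  continuous_time z := ((hV.continuous_time z).comp continuous_neg).neg
  lipschitz b := by
    obtain ⟨K, hK⟩ := hV.lipschitz b
    exact ⟨K, fun r hr => (hK (-r) ⟨by linarith [hr.2], by linarith [hr.1]⟩).neg⟩

variable [NormedSpace ℝ E]

/-- `Y` is a solution of `Y' = V(r, Y)` on the whole line. -/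
def IsSolution (V : ℝ → E → E) (Y : ℝ → E) : Prop :=
  ∀ r, HasDerivAt Y (V r (Y r)) r

theorem IsSolution.continuous {Y : ℝ → E} (hY : IsSolution V Y) : Continuous Y :=
  continuous_iff_continuousAt.2 fun r => (hY r).continuousAt

theorem dist_le_of_lipschitzWith {Y Y' : ℝ → E}
    {K : ℝ≥0} {s r : ℝ} (hK : ∀ q ∈ Icc s r, LipschitzWith K (V q)) (hsr : s ≤ r)
    (hYc : ContinuousOn Y (Icc s r)) (hY'c : ContinuousOn Y' (Icc s r))
    (hY : ∀ q ∈ Ico s r, HasDerivWithinAt Y (V q (Y q)) (Ici q) q)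
    (hY' : ∀ q ∈ Ico s r, HasDerivWithinAt Y' (V q (Y' q)) (Ici q) q) :
    dist (Y r) (Y' r) ≤ dist (Y s) (Y' s) * Real.exp (K * (r - s)) :=
  dist_le_of_trajectories_ODE_of_mem (s := fun _ => univ)
    (fun q hq => (hK q (Ico_subset_Icc_self hq)).lipschitzOnWith) hYc hY
    (fun _ _ => mem_univ _) hY'c hY' (fun _ _ => mem_univ _) le_rfl r (right_mem_Icc.2 hsr)

theorem IsSolution.reverse {Y : ℝ → E} (hY : IsSolution V Y) :
    IsSolution (fun r z => -V (-r) z) (fun r => Y (-r)) := fun r => by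
  simpa using! (hY (-r)).scomp r (hasDerivAt_neg r)

/-- Two global solutions separate at most exponentially, forward and backward in time. -/
theorem IsBoundedField.exists_dist_le (hV : IsBoundedField V R) (s r : ℝ) :
    ∃ L : ℝ≥0, ∀ Y Y' : ℝ → E, IsSolution V Y → IsSolution V Y' →
      dist (Y r) (Y' r) ≤ L * dist (Y s) (Y' s) := by
  obtain ⟨K, hK⟩ := hV.lipschitz (max |s| |r|)
  have hs : -max |s| |r| ≤ s ∧ s ≤ max |s| |r| := abs_le.1 (le_max_left _ _)
  have hr : -max |s| |r| ≤ r ∧ r ≤ max |s| |r| := abs_le.1 (le_max_right _ _)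
  refine ⟨(Real.exp (K * |r - s|)).toNNReal, fun Y Y' hY hY' => ?_⟩
  rw [Real.coe_toNNReal _ (Real.exp_pos _).le, mul_comm]
  rcases le_total s r with h | h
  · rw [abs_of_nonneg (sub_nonneg.2 h)]
    exact dist_le_of_lipschitzWith (fun q hq => hK q ⟨hs.1.trans hq.1, hq.2.trans hr.2⟩) h
      hY.continuous.continuousOn hY'.continuous.continuousOn
      (fun q _ => (hY q).hasDerivWithinAt) fun q _ => (hY' q).hasDerivWithinAt
  · have := dist_le_of_lipschitzWith (V := fun r z => -V (-r) z) (s := -s) (r := -r) (K := K)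
      (fun q hq => (hK (-q) ⟨by linarith [hq.2, hr.1], by linarith [hq.1, hs.2]⟩).neg)
      (neg_le_neg h)
      hY.reverse.continuous.continuousOn hY'.reverse.continuous.continuousOn
      (fun q _ => (hY.reverse q).hasDerivWithinAt) fun q _ => (hY'.reverse q).hasDerivWithinAt
    rw [abs_of_nonpos (sub_nonpos.2 h)]
    simpa [add_comm, sub_eq_add_neg] using this

theorem IsBoundedField.eq_of_eq_at (hV : IsBoundedField V R) {Y Y' : ℝ → E}
    (hY : IsSolution V Y) (hY' : IsSolution V Y') {s : ℝ} (h : Y s = Y' s) : Y = Y' := by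
  funext r
  obtain ⟨L, hL⟩ := hV.exists_dist_le s r
  simpa [h] using hL Y Y' hY hY'

/-- Solutions of a bounded field move with speed at most `R`. -/
theorem IsSolution.norm_sub_le (hV : IsBoundedField V R) {Y : ℝ → E} (hY : IsSolution V Y)
    (s r : ℝ) : ‖Y r - Y s‖ ≤ R * |r - s| := by
  simpa using convex_univ.norm_image_sub_le_of_norm_hasDerivWithin_le (C := R)
    (fun q _ => (hY q).hasDerivWithinAt) (fun q _ => hV.norm_le q _) (mem_univ s) (mem_univ r)

variable [CompleteSpace E]

/-- As the field is bounded, the Picard-Lindelöf theorem applies on every time interval, with a ball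
large enough to contain all curves of speed at most `R`. -/
theorem IsBoundedField.exists_solution_on (hV : IsBoundedField V R) (s : ℝ) (z : E) (n : ℕ) :
    ∃ Y : ℝ → E, Y s = z ∧ ∀ r ∈ Ioo (s - (n + 1)) (s + (n + 1)), HasDerivAt Y (V r (Y r)) r := by
  have hR : 0 ≤ R := (norm_nonneg _).trans (hV.norm_le s z)
  obtain ⟨K, hK⟩ := hV.lipschitz (|s| + (n + 1))
  have hn : (0 : ℝ) ≤ n := n.cast_nonneg
  have hPL : IsPicardLindelof V (tmin := s - (n + 1)) (tmax := s + (n + 1))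
      ⟨s, by constructor <;> linarith⟩ z (R.toNNReal * (n + 1)) 0 R.toNNReal K :=
    { lipschitzOnWith := fun t ht => (hK t ⟨by linarith [ht.1, neg_abs_le s],
        by linarith [ht.2, le_abs_self s]⟩).lipschitzOnWith
      continuousOn := fun x _ => (hV.continuous_time x).continuousOn
      norm_le := fun t _ x _ => by simpa [Real.coe_toNNReal _ hR] using hV.norm_le t x
      mul_max_le := by simp }
  obtain ⟨Y, hYs, hY⟩ := hPL.exists_eq_forall_mem_Icc_hasDerivWithinAt₀
  exact ⟨Y, hYs, fun r hr => (hY r (Ioo_subset_Icc_self hr)).hasDerivAt (Icc_mem_nhds hr.1 hr.2)⟩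

theorem IsBoundedField.exists_solution (hV : IsBoundedField V R) (s : ℝ) (z : E) :
    ∃ Y : ℝ → E, Y s = z ∧ IsSolution V Y := by
  choose Y hYs hY using hV.exists_solution_on s z
  -- The solutions on growing intervals agree by uniqueness and are glued.
  have agree : ∀ n m : ℕ, n ≤ m → EqOn (Y n) (Y m) (Ioo (s - (n + 1)) (s + (n + 1))) := by
    intro n m hnm
    obtain ⟨K, hK⟩ := hV.lipschitz (|s| + (n + 1))
    have hn : (0 : ℝ) ≤ n := n.cast_nonneg
    have hnm' : (n : ℝ) ≤ m := Nat.cast_le.2 hnm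
    refine ODE_solution_unique_of_mem_Ioo (s := fun _ => univ) (t₀ := s)
      (fun t ht => (hK t ⟨by linarith [ht.1, neg_abs_le s],
        by linarith [ht.2, le_abs_self s]⟩).lipschitzOnWith)
      ⟨by linarith, by linarith⟩ (fun t ht => ⟨hY n t ht, mem_univ _⟩)
      (fun t ht => ⟨hY m t ⟨by linarith [ht.1], by linarith [ht.2]⟩, mem_univ _⟩) ?_
    rw [hYs, hYs]
  refine ⟨fun r => Y ⌈|r - s|⌉₊ r, by simp [hYs], fun r => ?_⟩
  have hloc : ∀ n : ℕ, ∀ q, |q - s| < n + 1 → Y ⌈|q - s|⌉₊ q = Y n q := by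
    intro n q hq
    have h1 := Nat.le_ceil |q - s|
    have hm : ∀ x : ℝ, |q - s| < x + 1 → q ∈ Ioo (s - (x + 1)) (s + (x + 1)) := fun x hx => by
      have := abs_lt.1 hx
      constructor <;> linarith
    rcases le_total ⌈|q - s|⌉₊ n with h | h
    · exact agree _ _ h (hm _ (by linarith))
    · exact (agree _ _ h (hm _ hq)).symm
  set N := ⌈|r - s|⌉₊
  have hN : |r - s| < N + 1 := by linarith [Nat.le_ceil |r - s|]
  have hev : (fun q => Y ⌈|q - s|⌉₊ q) =ᶠ[𝓝 r] Y N := by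
    have : ∀ᶠ q in 𝓝 r, |q - s| < N + 1 :=
      ((continuous_id.sub continuous_const).abs.tendsto r).eventually (gt_mem_nhds hN)
    filter_upwards [this] with q hq using hloc N q hq
  have h2 := abs_lt.1 hN
  exact (hY N r ⟨by linarith, by linarith⟩).congr_of_eventuallyEq hev

/-- The flow of a bounded field: `hV.flow s r z` is the position at time `r` of the global solution
that is at `z` at time `s`. -/
noncomputable def IsBoundedField.flow (hV : IsBoundedField V R) (s r : ℝ) (z : E) : E :=
  (hV.exists_solution s z).choose r

theorem IsBoundedField.flow_self (hV : IsBoundedField V R) (s : ℝ) (z : E) :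
    hV.flow s s z = z := (hV.exists_solution s z).choose_spec.1

theorem IsBoundedField.isSolution_flow (hV : IsBoundedField V R) (s : ℝ) (z : E) :
    IsSolution V (hV.flow s · z) := (hV.exists_solution s z).choose_spec.2

theorem IsBoundedField.flow_flow (hV : IsBoundedField V R) (s q r : ℝ) (z : E) :
    hV.flow q r (hV.flow s q z) = hV.flow s r z :=
  congrFun (hV.eq_of_eq_at (hV.isSolution_flow q _) (hV.isSolution_flow s z)
    (hV.flow_self q _)) r

theorem IsBoundedField.exists_lipschitzWith_flow (hV : IsBoundedField V R) (s r : ℝ) :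
    ∃ L : ℝ≥0, LipschitzWith L (hV.flow s r) := by
  obtain ⟨L, hL⟩ := hV.exists_dist_le s r
  refine ⟨L, LipschitzWith.of_dist_le_mul fun z z' => ?_⟩
  simpa [hV.flow_self] using hL _ _ (hV.isSolution_flow s z) (hV.isSolution_flow s z')

theorem IsBoundedField.continuous_flow (hV : IsBoundedField V R) (s r : ℝ) :
    Continuous (hV.flow s r) :=
  (hV.exists_lipschitzWith_flow s r).choose_spec.continuous

/-- Following a straight line of velocity `y` for a time `h` and then flowing back for the same time
gives a curve with initial velocity `y - V`. -/
theorem IsBoundedField.hasDerivAt_flow_back (hV : IsBoundedField V R) (r : ℝ) (z y : E) :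
    HasDerivAt (fun q => hV.flow q r (z + (q - r) • y)) (y - V r z) r := by
  rw [hasDerivAt_iff_isLittleO, Asymptotics.isLittleO_iff]
  intro ε hε
  have hR : 0 ≤ R := (norm_nonneg _).trans (hV.norm_le r z)
  obtain ⟨δ, hδ, hcont⟩ := Metric.continuousAt_iff.1
    (hV.continuous_uncurry.continuousAt (x := (r, z))) ε hε
  have hB : 0 < 1 + ‖y‖ + R := by positivity
  filter_upwards [Metric.ball_mem_nhds r (div_pos hδ hB)] with q hq
  rw [Metric.mem_ball, Real.dist_eq, lt_div_iff₀ hB] at hq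
  set Y := (hV.flow q · (z + (q - r) • y)) with hYdef
  have hYs : IsSolution V Y := hV.isSolution_flow q _
  have hYq : Y q = z + (q - r) • y := hV.flow_self q _
  -- On the segment between `r` and `q` the field is within `ε` of `V r z` along the solution.
  have hb : ∀ p ∈ uIcc q r, ‖V p (Y p) - V r z‖ ≤ ε := by
    intro p hp
    have hp1 : |p - q| ≤ |q - r| := by
      rw [abs_sub_comm q r]; exact abs_sub_left_of_mem_uIcc hp
    have hp2 : |p - r| ≤ |q - r| := by
      rw [uIcc_comm] at hp; exact abs_sub_left_of_mem_uIcc hp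
    have h1 : ‖Y p - z‖ ≤ (‖y‖ + R) * |q - r| := by
      calc ‖Y p - z‖ = ‖(Y p - Y q) + (q - r) • y‖ := by rw [hYq]; congr 1; abel
        _ ≤ R * |p - q| + |q - r| * ‖y‖ := by
          refine (norm_add_le _ _).trans (add_le_add (hYs.norm_sub_le hV q p) ?_)
          rw [norm_smul, Real.norm_eq_abs]
        _ ≤ R * |q - r| + |q - r| * ‖y‖ := by gcongr
        _ = _ := by ring
    have h2 : dist (p, Y p) (r, z) < δ := by
      rw [Prod.dist_eq, max_lt_iff, Real.dist_eq, dist_eq_norm]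
      have h0 := abs_nonneg (q - r)
      constructor
      · nlinarith [norm_nonneg y]
      · nlinarith [norm_nonneg y]
    have := hcont h2
    rw [dist_eq_norm] at this
    exact this.le
  have hmv := (convex_uIcc q r).norm_image_sub_le_of_norm_hasDerivWithin_le (C := ε)
    (f := fun p => Y p - p • V r z) (f' := fun p => V p (Y p) - V r z)
    (fun p _ => by
      simpa using! ((hYs p).sub ((hasDerivAt_id p).smul_const (V r z))).hasDerivWithinAt)
    hb left_mem_uIcc right_mem_uIcc
  have heq : Y r - hV.flow r r (z + (r - r) • y) - (q - r) • (y - V r z)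
      = (Y r - r • V r z) - (Y q - q • V r z) := by
    rw [hYq, hV.flow_self]; module
  rw [heq]
  refine hmv.trans_eq ?_
  rw [norm_sub_rev]

end GlobalFlow

/-! ### The posterior mean -/

section PosteriorMean

theorem exp_neg_sq_div_le_one (x : ℝ) : Real.exp (-x ^ 2 / 4) ≤ 1 :=
  Real.exp_le_one_iff.2 (by nlinarith [sq_nonneg x])

variable {E : Type*} [NormedAddCommGroup E] [InnerProductSpace ℝ E]

/-- The exponent `r ⟪z, y⟫ / 2 - r² ‖y‖² / 4`. It equals `-‖z - r y‖² / 4` up to a term that does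
not depend on `y`. -/
noncomputable def posteriorExponent (r : ℝ) (z y : E) : ℝ :=
  r / 2 * ⟪z, y⟫ - r ^ 2 / 4 * ‖y‖ ^ 2

theorem posteriorExponent_eq (r : ℝ) (z y : E) :
    posteriorExponent r z y = ‖z‖ ^ 2 / 4 - ‖z - r • y‖ ^ 2 / 4 := by
  rw [posteriorExponent, norm_sub_sq_real, inner_smul_right, norm_smul, mul_pow, Real.norm_eq_abs,
    sq_abs]
  ring

theorem continuous_posteriorExponent (r : ℝ) (z : E) : Continuous (posteriorExponent r z) := by
  unfold posteriorExponent; fun_prop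

theorem abs_posteriorExponent_sub_le {ρ : ℝ} (r r' : ℝ) (z z' : E) {y : E} (hy : ‖y‖ ≤ ρ) :
    |posteriorExponent r z y - posteriorExponent r' z' y|
      ≤ ‖r • z - r' • z'‖ * ρ / 2 + |r ^ 2 - r' ^ 2| * ρ ^ 2 / 4 := by
  have e : posteriorExponent r z y - posteriorExponent r' z' y
      = ⟪r • z - r' • z', y⟫ / 2 - (r ^ 2 - r' ^ 2) * ‖y‖ ^ 2 / 4 := by
    rw [inner_sub_left, inner_smul_left, inner_smul_left, posteriorExponent, posteriorExponent]
    simp only [conj_trivial]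
    ring
  rw [e]
  refine (abs_sub _ _).trans (add_le_add ?_ ?_)
  · rw [abs_div, abs_two]
    gcongr
    exact (abs_real_inner_le_norm _ _).trans (by gcongr)
  · rw [abs_div, abs_mul, abs_of_nonneg (by positivity : 0 ≤ ‖y‖ ^ 2)]
    norm_num
    gcongr

variable [MeasurableSpace E]

/-- The posterior mean `𝔼[y | r y + G = z]`, where `y` has law `u` and `G` is an independent
Gaussian with density proportional to `exp (-‖g‖² / 4)`. -/
noncomputable def posteriorMean (u : Measure E) (r : ℝ) (z : E) : E :=
  ∫ y, y ∂(u.tilted (posteriorExponent r z))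

variable [BorelSpace E] {u : Measure E} [IsProbabilityMeasure u] {ρ : ℝ}

theorem integrable_exp_posteriorExponent (hu : ∀ᵐ y ∂u, ‖y‖ ≤ ρ) (r : ℝ) (z : E) :
    Integrable (fun y => Real.exp (posteriorExponent r z y)) u := by
  refine Integrable.of_bound
    ((Real.continuous_exp.comp (continuous_posteriorExponent r z)).aestronglyMeasurable)
    (Real.exp (‖r • z‖ * ρ / 2 + |r ^ 2| * ρ ^ 2 / 4)) ?_
  filter_upwards [hu] with y hy
  rw [Real.norm_eq_abs, Real.abs_exp]
  refine Real.exp_le_exp.2 ((le_abs_self _).trans ?_)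
  have h := abs_posteriorExponent_sub_le r 0 z 0 hy
  simpa [posteriorExponent] using h

theorem isProbabilityMeasure_tilted_posteriorExponent (hu : ∀ᵐ y ∂u, ‖y‖ ≤ ρ) (r : ℝ) (z : E) :
    IsProbabilityMeasure (u.tilted (posteriorExponent r z)) :=
  isProbabilityMeasure_tilted (integrable_exp_posteriorExponent hu r z)

theorem norm_posteriorMean_le (hu : ∀ᵐ y ∂u, ‖y‖ ≤ ρ) (r : ℝ) (z : E) :
    ‖posteriorMean u r z‖ ≤ ρ := by
  have := isProbabilityMeasure_tilted_posteriorExponent hu r z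
  simpa [posteriorMean] using norm_integral_le_of_norm_le_const
    ((tilted_absolutelyContinuous u (posteriorExponent r z)).ae_le hu)

variable [FiniteDimensional ℝ E]

/-- The mean of a probability measure carried by the ball of radius `ρ` moves by `O(ε)` when the
measure is tilted by a function bounded by `ε`. -/
theorem norm_integral_tilted_sub_le {ε : ℝ}
    (hu : ∀ᵐ y ∂u, ‖y‖ ≤ ρ) {c : E → ℝ} (hc : AEStronglyMeasurable c u)
    (hcε : ∀ᵐ y ∂u, |c y| ≤ ε) :
    ‖∫ y, y ∂(u.tilted c) - ∫ y, y ∂u‖ ≤ 12 * ρ * ε := by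
  have hρ : 0 ≤ ρ := by
    obtain ⟨y, hy⟩ := hu.exists
    exact (norm_nonneg y).trans hy
  have hε : 0 ≤ ε := by
    obtain ⟨y, hy⟩ := hcε.exists
    exact (abs_nonneg _).trans hy
  have hexpm : AEStronglyMeasurable (fun y => Real.exp (c y)) u :=
    Real.continuous_exp.comp_aestronglyMeasurable hc
  have hexp : Integrable (fun y => Real.exp (c y)) u := by
    refine Integrable.of_bound hexpm (Real.exp ε) ?_
    filter_upwards [hcε] with y hy
    rw [Real.norm_eq_abs, Real.abs_exp]
    exact Real.exp_le_exp.2 ((le_abs_self _).trans hy)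
  have hid : Integrable (fun y : E => y) u :=
    Integrable.of_bound aestronglyMeasurable_id ρ hu
  have hexpid : Integrable (fun y : E => Real.exp (c y) • y) u := by
    refine Integrable.of_bound (hexpm.smul aestronglyMeasurable_id) (Real.exp ε * ρ) ?_
    filter_upwards [hcε, hu] with y hy hy'
    rw [norm_smul, Real.norm_eq_abs, Real.abs_exp]
    gcongr
    exact (le_abs_self _).trans hy
  have : IsProbabilityMeasure (u.tilted c) := isProbabilityMeasure_tilted hexp
  have hu' : ∀ᵐ y ∂(u.tilted c), ‖y‖ ≤ ρ := (tilted_absolutelyContinuous u c).ae_le hu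
  set m := ∫ y, y ∂u with hm
  have hmρ : ‖m‖ ≤ ρ := by simpa using norm_integral_le_of_norm_le_const hu
  -- For `ε > 1` the trivial bound `2 ρ` suffices.
  rcases le_or_gt ε 1 with h1 | h1
  · set Z := ∫ y, Real.exp (c y) ∂u with hZ
    have hZ3 : 1 / 3 ≤ Z := by
      have hle : ∫ _, Real.exp (-1) ∂u ≤ Z := by
        refine integral_mono_ae (integrable_const _) hexp ?_
        filter_upwards [hcε] with y hy
        exact Real.exp_le_exp.2 (by linarith [(abs_le.1 hy).1])
      simp only [integral_const, probReal_univ, smul_eq_mul, one_mul] at hle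
      refine le_trans ?_ hle
      rw [Real.exp_neg, one_div]
      exact inv_anti₀ (Real.exp_pos _) (by linarith [Real.exp_one_lt_d9])
    have hZ0 : 0 < Z := by linarith
    -- Centring at `m` brings out the small factor `exp c - 1`.
    have key : ∫ y, y ∂(u.tilted c) - m
        = Z⁻¹ • ∫ y, (Real.exp (c y) - 1) • (y - m) ∂u := by
      have e1 : ∫ y, (Real.exp (c y) - 1) • (y - m) ∂u
          = ∫ y, Real.exp (c y) • y ∂u - Z • m := by
        have : ∀ y : E, (Real.exp (c y) - 1) • (y - m)
            = (Real.exp (c y) • y - Real.exp (c y) • m) - (y - m) := fun y => by module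
        simp_rw [this]
        rw [integral_sub (f := fun y => Real.exp (c y) • y - Real.exp (c y) • m)
            (g := fun y => y - m) (hexpid.sub (hexp.smul_const m)) (hid.sub (integrable_const m)),
          integral_sub hexpid (hexp.smul_const m), integral_smul_const,
          integral_sub hid (integrable_const m)]
        simp [hm, hZ]
      rw [e1, smul_sub, smul_smul, inv_mul_cancel₀ hZ0.ne', one_smul, integral_tilted,
        ← integral_smul]
      congr 2
      funext y
      rw [smul_smul, div_eq_inv_mul]
    have hbd : ‖∫ y, (Real.exp (c y) - 1) • (y - m) ∂u‖ ≤ 2 * ε * (2 * ρ) := by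
      refine (norm_integral_le_of_norm_le_const (C := 2 * ε * (2 * ρ)) ?_).trans_eq (by simp)
      filter_upwards [hcε, hu] with y hy hy'
      rw [norm_smul, Real.norm_eq_abs]
      refine mul_le_mul ?_ ?_ (norm_nonneg _) (by positivity)
      · exact (Real.abs_exp_sub_one_le (hy.trans h1)).trans (by linarith)
      · exact (norm_sub_le _ _).trans (by linarith)
    rw [key, norm_smul, norm_inv, Real.norm_of_nonneg hZ0.le]
    have hZinv : Z⁻¹ ≤ 3 := by
      rw [inv_le_comm₀ hZ0 (by norm_num)]; linarith
    calc Z⁻¹ * ‖∫ y, (Real.exp (c y) - 1) • (y - m) ∂u‖ ≤ 3 * (2 * ε * (2 * ρ)) := by gcongr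
      _ = 12 * ρ * ε := by ring
  · have h2 : ‖∫ y, y ∂(u.tilted c)‖ ≤ ρ := by simpa using norm_integral_le_of_norm_le_const hu'
    refine (norm_sub_le _ _).trans ?_
    nlinarith

theorem posteriorMean_mem (hu : ∀ᵐ y ∂u, ‖y‖ ≤ ρ) {K : Set E} (hK : Convex ℝ K)
    (hKc : IsClosed K) (huK : ∀ᵐ y ∂u, y ∈ K) (r : ℝ) (z : E) : posteriorMean u r z ∈ K := by
  have := isProbabilityMeasure_tilted_posteriorExponent hu r z
  have hac := (tilted_absolutelyContinuous u (posteriorExponent r z)).ae_le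
  exact hK.integral_mem hKc (hac huK)
    (Integrable.of_bound aestronglyMeasurable_id ρ (hac hu))

theorem norm_posteriorMean_sub_le (hu : ∀ᵐ y ∂u, ‖y‖ ≤ ρ) (r r' : ℝ) (z z' : E) :
    ‖posteriorMean u r z - posteriorMean u r' z'‖
      ≤ 12 * ρ * (‖r • z - r' • z'‖ * ρ / 2 + |r ^ 2 - r' ^ 2| * ρ ^ 2 / 4) := by
  have := isProbabilityMeasure_tilted_posteriorExponent hu r' z'
  have h1 : u.tilted (posteriorExponent r z) = (u.tilted (posteriorExponent r' z')).tilted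
      (posteriorExponent r z - posteriorExponent r' z') := by
    rw [tilted_tilted (integrable_exp_posteriorExponent hu r' z')]
    congr 1
    abel
  have hu' := (tilted_absolutelyContinuous u (posteriorExponent r' z')).ae_le hu
  rw [posteriorMean, posteriorMean, h1]
  refine norm_integral_tilted_sub_le hu' ((continuous_posteriorExponent r z).sub
    (continuous_posteriorExponent r' z')).aestronglyMeasurable ?_
  filter_upwards [hu'] with y hy using abs_posteriorExponent_sub_le r r' z z' hy

theorem isBoundedField_posteriorMean (hu : ∀ᵐ y ∂u, ‖y‖ ≤ ρ) :
    IsBoundedField (posteriorMean u) ρ where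
  norm_le := norm_posteriorMean_le hu
  continuous_time z := by
    refine continuous_iff_continuousAt.2 fun r => ?_
    refine tendsto_iff_norm_sub_tendsto_zero.2 (squeeze_zero (fun _ => norm_nonneg _)
      (fun r' => norm_posteriorMean_sub_le hu r' r z z) ?_)
    have : Continuous fun r' : ℝ =>
        12 * ρ * (‖r' • z - r • z‖ * ρ / 2 + |r' ^ 2 - r ^ 2| * ρ ^ 2 / 4) := by fun_prop
    simpa using this.tendsto r
  lipschitz b := by
    refine ⟨(12 * ρ * (|b| * ρ / 2)).toNNReal, fun r hr => LipschitzWith.of_dist_le_mul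
      fun z z' => ?_⟩
    have hρ : 0 ≤ ρ := (norm_nonneg _).trans (norm_posteriorMean_le hu r z)
    have hrb : |r| ≤ |b| := by
      have := le_abs_self b
      exact abs_le.2 ⟨by linarith [hr.1], by linarith [hr.2]⟩
    rw [Real.coe_toNNReal _ (by positivity), dist_eq_norm, dist_eq_norm]
    refine (norm_posteriorMean_sub_le hu r r z z').trans ?_
    rw [← smul_sub, norm_smul, sub_self, abs_zero, Real.norm_eq_abs]
    calc 12 * ρ * (|r| * ‖z - z'‖ * ρ / 2 + 0 * ρ ^ 2 / 4)
        = 12 * ρ * (|r| * ρ / 2) * ‖z - z'‖ := by ring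
      _ ≤ _ := by gcongr

/-- The defining orthogonality relation of the posterior mean. -/
theorem integral_exp_smul_sub_posteriorMean (hu : ∀ᵐ y ∂u, ‖y‖ ≤ ρ) (r : ℝ) (z : E) :
    ∫ y, Real.exp (-‖z - r • y‖ ^ 2 / 4) • (y - posteriorMean u r z) ∂u = 0 := by
  have hint := integrable_exp_posteriorExponent hu r z
  have hint' : Integrable (fun y => Real.exp (posteriorExponent r z y) • y) u :=
    hint.smul_bdd ρ aestronglyMeasurable_id hu
  have hZ : ∫ y, Real.exp (posteriorExponent r z y) ∂u ≠ 0 := (integral_exp_pos hint).ne'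
  have e : ∀ y, Real.exp (-‖z - r • y‖ ^ 2 / 4) • (y - posteriorMean u r z)
      = Real.exp (-‖z‖ ^ 2 / 4) • (Real.exp (posteriorExponent r z y) • y
        - Real.exp (posteriorExponent r z y) • posteriorMean u r z) := by
    intro y
    rw [← smul_sub, smul_smul, ← Real.exp_add, posteriorExponent_eq]
    congr 2
    ring
  simp_rw [e]
  rw [integral_smul, integral_sub hint' (hint.smul_const _), integral_smul_const, posteriorMean,
    integral_tilted]
  simp_rw [div_eq_inv_mul, mul_smul]
  rw [integral_smul, smul_smul, mul_inv_cancel₀ hZ, one_smul, sub_self, smul_zero]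

theorem integrable_gaussian_smul_sub (hu : ∀ᵐ y ∂u, ‖y‖ ≤ ρ) (r : ℝ) (z b : E) :
    Integrable (fun y => Real.exp (-‖z - r • y‖ ^ 2 / 4) • (y - b)) u := by
  refine Integrable.of_bound (by fun_prop) (ρ + ‖b‖) ?_
  filter_upwards [hu] with y hy
  rw [norm_smul, Real.norm_eq_abs, Real.abs_exp]
  refine (mul_le_of_le_one_left (norm_nonneg _) (exp_neg_sq_div_le_one _)).trans ?_
  exact (norm_sub_le _ _).trans (by linarith)

theorem integrable_gaussian (r : ℝ) (z : E) :
    Integrable (fun y => Real.exp (-‖z - r • y‖ ^ 2 / 4)) u :=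
  Integrable.of_bound (by fun_prop) 1 (ae_of_all _ fun y => by
    rw [Real.norm_eq_abs, Real.abs_exp]; exact exp_neg_sq_div_le_one _)

/-- The posterior mean relative to an arbitrary base point `b`. -/
theorem integral_gaussian_smul_posteriorMean_sub (hu : ∀ᵐ y ∂u, ‖y‖ ≤ ρ) (r : ℝ) (z b : E) :
    (∫ y, Real.exp (-‖z - r • y‖ ^ 2 / 4) ∂u) • (posteriorMean u r z - b)
      = ∫ y, Real.exp (-‖z - r • y‖ ^ 2 / 4) • (y - b) ∂u := by
  have h := integral_exp_smul_sub_posteriorMean hu r z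
  rw [← integral_smul_const, ← sub_eq_zero, ← integral_sub
    ((integrable_gaussian r z).smul_const _) (integrable_gaussian_smul_sub hu r z b), ← neg_eq_zero,
    ← integral_neg, ← h]
  congr 1
  funext y
  module

end PosteriorMean

/-! ### Transport of the noised law along the flow -/

section Transport

variable {E : Type*} [NormedAddCommGroup E] [InnerProductSpace ℝ E] [FiniteDimensional ℝ E]
  [MeasurableSpace E] [BorelSpace E]

theorem integrable_exp_neg_mul_sq_norm {b : ℝ} (hb : 0 < b) :
    Integrable (fun g : E => Real.exp (-b * ‖g‖ ^ 2)) := by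
  have h := (GaussianFourier.integrable_cexp_neg_mul_sq_norm_add (V := E) (b := (b : ℂ))
    (by simpa using hb) 0 0).norm
  refine h.congr (ae_of_all _ fun g => ?_)
  simp only [Complex.norm_exp]
  congr 1
  simp [← Complex.ofReal_pow, ← Complex.ofReal_mul]

variable (E) in
/-- The Gaussian measure with density `exp (-‖g‖² / 4)`. It is not normalized: a constant factor
affects neither its null sets nor the identities between its integrals. -/
noncomputable def gaussianWeight : Measure E :=
  volume.withDensity fun g => ENNReal.ofReal (Real.exp (-‖g‖ ^ 2 / 4))

omit [InnerProductSpace ℝ E] [FiniteDimensional ℝ E] in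
theorem measurable_gaussianWeight_density :
    Measurable fun g : E => ENNReal.ofReal (Real.exp (-‖g‖ ^ 2 / 4)) := by
  fun_prop

instance isFiniteMeasure_gaussianWeight : IsFiniteMeasure (gaussianWeight E) := by
  refine isFiniteMeasure_withDensity_ofReal ?_
  refine ((integrable_exp_neg_mul_sq_norm (E := E) (b := 1 / 4) (by norm_num)).congr
    (ae_of_all _ fun g => ?_)).2
  ring_nf

theorem ae_gaussianWeight_iff {p : E → Prop} :
    (∀ᵐ g ∂gaussianWeight E, p g) ↔ ∀ᵐ g : E, p g := by
  rw [gaussianWeight, ae_withDensity_iff measurable_gaussianWeight_density]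
  simp [Real.exp_pos]

theorem integral_gaussianWeight (F : E → ℝ) :
    ∫ g, F g ∂gaussianWeight E = ∫ g, Real.exp (-‖g‖ ^ 2 / 4) * F g := by
  rw [gaussianWeight, integral_withDensity_eq_integral_toReal_smul
    measurable_gaussianWeight_density (by simp)]
  simp [ENNReal.toReal_ofReal (Real.exp_pos _).le]

omit [InnerProductSpace ℝ E] [FiniteDimensional ℝ E] in
theorem ae_add_left_iff {μ : Measure E} [μ.IsAddLeftInvariant] {p : E → Prop} (a : E) :
    (∀ᵐ g ∂μ, p (a + g)) ↔ ∀ᵐ g ∂μ, p g := by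
  constructor
  · intro h
    simpa using (measurePreserving_add_left μ (-a)).quasiMeasurePreserving.ae h
  · exact (measurePreserving_add_left μ a).quasiMeasurePreserving.ae

variable {u : Measure E} [IsProbabilityMeasure u] {ρ : ℝ}

theorem continuous_posteriorMean (hu : ∀ᵐ y ∂u, ‖y‖ ≤ ρ) (r : ℝ) :
    Continuous (posteriorMean u r) := by
  obtain ⟨K, hK⟩ := (isBoundedField_posteriorMean hu).lipschitz |r|
  exact (hK r ⟨neg_abs_le r, le_abs_self r⟩).continuous

/-- Given the noised point `r y + g`, the velocity `y - 𝔼[y | r y + g]` has mean zero. -/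
theorem integral_clm_sub_posteriorMean_eq_zero (hu : ∀ᵐ y ∂u, ‖y‖ ≤ ρ) (r : ℝ)
    {A : E → E →L[ℝ] ℝ} (hA : Measurable A) {C : ℝ} (hAC : ∀ z, ‖A z‖ ≤ C) :
    ∫ p, A (r • p.1 + p.2) (p.1 - posteriorMean u r (r • p.1 + p.2)) ∂u.prod (gaussianWeight E)
      = 0 := by
  have hC : 0 ≤ C := (norm_nonneg _).trans (hAC 0)
  have hM := continuous_posteriorMean hu r
  have happ : Measurable fun p : (E →L[ℝ] ℝ) × E => p.1 p.2 :=
    isBoundedBilinearMap_apply.continuous.measurable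
  have hmeas : Measurable fun p : E × E => A p.2 (p.1 - posteriorMean u r p.2) :=
    happ.comp ((hA.comp measurable_snd).prodMk
      (measurable_fst.sub (hM.measurable.comp measurable_snd)))
  have hshear : Measurable fun p : E × E => (p.1, r • p.1 + p.2) := by fun_prop
  have hbd : ∀ y z : E, ‖y‖ ≤ ρ → ‖A z (y - posteriorMean u r z)‖ ≤ C * (2 * ρ) := by
    intro y z hy
    refine ((A z).le_opNorm _).trans ?_
    gcongr
    · exact hAC z
    · refine (norm_sub_le _ _).trans ?_
      linarith [norm_posteriorMean_le hu r z]
  have hu1 {ν : Measure E} [SFinite ν] : ∀ᵐ p ∂u.prod ν, ‖p.1‖ ≤ ρ :=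
    Measure.quasiMeasurePreserving_fst.ae hu
  have hint1 : Integrable (fun p : E × E => A (r • p.1 + p.2)
      (p.1 - posteriorMean u r (r • p.1 + p.2))) (u.prod (gaussianWeight E)) := by
    refine Integrable.of_bound (hmeas.comp hshear).aestronglyMeasurable (C * (2 * ρ)) ?_
    filter_upwards [hu1] with p hp using hbd _ _ hp
  -- The Gaussian factor is dominated by a centred Gaussian, uniformly over bounded `y`.
  have hint2 : Integrable (fun p : E × E => Real.exp (-‖p.2 - r • p.1‖ ^ 2 / 4)
      * A p.2 (p.1 - posteriorMean u r p.2)) (u.prod volume) := by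
    have hdom : Integrable (fun p : E × E => Real.exp (r ^ 2 * ρ ^ 2 / 4) * (C * (2 * ρ))
        * Real.exp (-(1 / 8) * ‖p.2‖ ^ 2)) (u.prod volume) :=
      ((integrable_exp_neg_mul_sq_norm (by norm_num)).comp_snd u).const_mul _
    refine hdom.mono' ((by fun_prop : Measurable _).mul hmeas).aestronglyMeasurable ?_
    filter_upwards [hu1] with p hp
    rw [norm_mul, Real.norm_eq_abs, Real.abs_exp, mul_right_comm, ← Real.exp_add]
    refine mul_le_mul (Real.exp_le_exp.2 ?_) (hbd _ _ hp) (norm_nonneg _) (Real.exp_pos _).le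
    have h1 : ‖p.2‖ ≤ ‖p.2 - r • p.1‖ + ‖r • p.1‖ := by
      simpa using norm_add_le (p.2 - r • p.1) (r • p.1)
    have h2 : ‖r • p.1‖ ^ 2 ≤ r ^ 2 * ρ ^ 2 := by
      rw [norm_smul, mul_pow, Real.norm_eq_abs, sq_abs]
      gcongr
    have h3 : ‖p.2‖ ^ 2 ≤ (‖p.2 - r • p.1‖ + ‖r • p.1‖) ^ 2 := by gcongr
    nlinarith [sq_nonneg (‖p.2 - r • p.1‖ - ‖r • p.1‖)]
  rw [integral_prod _ hint1]
  have hinner : ∀ y : E, ∫ g, A (r • y + g) (y - posteriorMean u r (r • y + g)) ∂gaussianWeight E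
      = ∫ z, Real.exp (-‖z - r • y‖ ^ 2 / 4) * A z (y - posteriorMean u r z) := by
    intro y
    rw [integral_gaussianWeight, ← integral_add_left_eq_self
      (fun z => Real.exp (-‖z - r • y‖ ^ 2 / 4) * A z (y - posteriorMean u r z)) (r • y)]
    simp
  simp_rw [hinner]
  rw [integral_integral_swap hint2]
  refine integral_eq_zero_of_ae (ae_of_all _ fun z => ?_)
  have := (A z).integral_comp_comm
    (integrable_gaussian_smul_sub hu r z (posteriorMean u r z))
  rw [integral_exp_smul_sub_posteriorMean hu, map_zero] at this
  simpa using this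

/-- The expected observable at the endpoint, as a function of the starting time, has derivative
zero: along the straight lines `q ↦ q y + g`, flowing back to a fixed time produces curves with
velocity `y - 𝔼[y | r y + g]`; Rademacher's theorem makes the Lipschitz
observable differentiable at almost every starting point. -/
theorem hasDerivAt_integral_flow (hu : ∀ᵐ y ∂u, ‖y‖ ≤ ρ) {f : E → ℝ} {L C : ℝ≥0}
    (hf : LipschitzWith L f) (hfC : ∀ z, ‖f z‖ ≤ C) (r s : ℝ) :
    HasDerivAt (fun q => ∫ p, f ((isBoundedField_posteriorMean hu).flow q s (q • p.1 + p.2))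
      ∂u.prod (gaussianWeight E)) 0 r := by
  set hV := isBoundedField_posteriorMean hu
  -- `F` maps a point at the fixed time `r` to the observable at the endpoint of its trajectory.
  obtain ⟨L', hL'⟩ := hV.exists_lipschitzWith_flow r s
  set F : E → ℝ := f ∘ hV.flow r s with hF
  have hFL : LipschitzWith (L * L') F := hf.comp hL'
  have hcurve : ∀ (q : ℝ) (p : E × E), f (hV.flow q s (q • p.1 + p.2))
      = F (hV.flow q r ((r • p.1 + p.2) + (q - r) • p.1)) := by
    intro q p
    rw [hF, Function.comp_apply, hV.flow_flow]
    congr 2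
    module
  have hz : Measurable fun p : E × E => r • p.1 + p.2 := by fun_prop
  have hu1 : ∀ᵐ p ∂u.prod (gaussianWeight E), ‖p.1‖ ≤ ρ :=
    Measure.quasiMeasurePreserving_fst.ae hu
  have hdiff : ∀ᵐ p ∂u.prod (gaussianWeight E), DifferentiableAt ℝ F (r • p.1 + p.2) := by
    have hms : MeasurableSet {p : E × E | DifferentiableAt ℝ F (r • p.1 + p.2)} :=
      hz (measurableSet_of_differentiableAt ℝ F)
    refine (Measure.ae_prod_iff_ae_ae hms).2 (ae_of_all _ fun y => ?_)
    exact ae_gaussianWeight_iff.2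
      ((ae_add_left_iff (p := fun z => DifferentiableAt ℝ F z) (r • y)).2
        hFL.ae_differentiableAt)
  set F' : E × E → ℝ := fun p =>
    fderiv ℝ F (r • p.1 + p.2) (p.1 - posteriorMean u r (r • p.1 + p.2)) with hF'
  have hF'm : Measurable F' :=
    (isBoundedBilinearMap_apply (𝕜 := ℝ) (E := E) (F := ℝ)).continuous.measurable.comp
      (((measurable_fderiv ℝ F).comp hz).prodMk
      (measurable_fst.sub ((continuous_posteriorMean hu r).measurable.comp hz)))
  have hmeas : ∀ q, Measurable fun p : E × E => f (hV.flow q s (q • p.1 + p.2)) := fun q =>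
    (hf.continuous.comp ((hV.continuous_flow q s).comp (by fun_prop))).measurable
  have key := hasFDerivAt_integral_of_dominated_loc_of_lip' (𝕜 := ℝ) (x₀ := r) (s := univ)
    (μ := u.prod (gaussianWeight E))
    (F := fun q p => f (hV.flow q s (q • p.1 + p.2)))
    (F' := fun p => ContinuousLinearMap.toSpanSingleton ℝ (F' p))
    (bound := fun _ => (L * L' : ℝ≥0) * (2 * ρ)) univ_mem
    (fun q _ => (hmeas q).aestronglyMeasurable)
    (Integrable.of_bound (hmeas r).aestronglyMeasurable C (ae_of_all _ fun p => hfC _))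
    ((ContinuousLinearMap.toSpanSingletonCLE (𝕜 := ℝ) (E := ℝ)).continuous.comp_aestronglyMeasurable
      hF'm.aestronglyMeasurable) ?_ (integrable_const _) ?_
  · have hd := key.2.hasDerivAt
    rw [ContinuousLinearMap.integral_apply key.1] at hd
    simp only [ContinuousLinearMap.toSpanSingleton_apply, one_smul] at hd
    rwa [hF', integral_clm_sub_posteriorMean_eq_zero hu r (measurable_fderiv ℝ F)
      (fun z => norm_fderiv_le_of_lipschitz ℝ hFL)] at hd
  · filter_upwards [hu1] with p hp q _
    rw [hcurve q p, hcurve r p, hV.flow_self, sub_self, zero_smul, add_zero]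
    refine (hFL.norm_sub_le _ _).trans ?_
    rw [mul_assoc]
    gcongr
    set w := r • p.1 + p.2 + (q - r) • p.1 with hw
    have h1 := (hV.isSolution_flow q w).norm_sub_le hV q r
    simp only [hV.flow_self] at h1
    calc ‖hV.flow q r w - (r • p.1 + p.2)‖ = ‖(hV.flow q r w - w) + (q - r) • p.1‖ := by
          congr 1; rw [hw]; abel
      _ ≤ ρ * |r - q| + |q - r| * ρ := by
          refine (norm_add_le _ _).trans (add_le_add h1 ?_)
          rw [norm_smul, Real.norm_eq_abs]
          gcongr
      _ = 2 * ρ * ‖q - r‖ := by rw [Real.norm_eq_abs, abs_sub_comm r q]; ring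
  · filter_upwards [hdiff] with p hp
    have hc := hV.hasDerivAt_flow_back r (r • p.1 + p.2) p.1
    set c : ℝ → E := fun q => hV.flow q r (r • p.1 + p.2 + (q - r) • p.1)
    have hcr : c r = r • p.1 + p.2 := by simp [c, hV.flow_self]
    have hp' : HasFDerivAt F (fderiv ℝ F (r • p.1 + p.2)) (c r) := by
      rw [hcr]; exact hp.hasFDerivAt
    have := (hp'.comp_hasDerivAt r hc).hasFDerivAt
    refine this.congr_of_eventuallyEq (Eventually.of_forall fun q => hcurve q p)

/-- The flow of the posterior mean started at time `s` from the law of `s y + G` has at time `r` the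
law of `r y + G`. -/
theorem integral_flow_eq (hu : ∀ᵐ y ∂u, ‖y‖ ≤ ρ) {f : E → ℝ} {L C : ℝ≥0}
    (hf : LipschitzWith L f) (hfC : ∀ z, ‖f z‖ ≤ C) (s r : ℝ) :
    ∫ p, f ((isBoundedField_posteriorMean hu).flow s r (s • p.1 + p.2)) ∂u.prod (gaussianWeight E)
      = ∫ p, f (r • p.1 + p.2) ∂u.prod (gaussianWeight E) := by
  have h := fun q => hasDerivAt_integral_flow hu hf hfC q r
  have := is_const_of_deriv_eq_zero (fun q => (h q).differentiableAt) (fun q => (h q).deriv) s r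
  rw [this]
  simp_rw [IsBoundedField.flow_self]

end Transport

/-! ### Almost every trajectory accumulates on the support -/

section Accumulation

variable {E : Type*} [NormedAddCommGroup E] [InnerProductSpace ℝ E] [FiniteDimensional ℝ E]
  [MeasurableSpace E] [BorelSpace E] {u : Measure E} [IsProbabilityMeasure u] {ρ : ℝ}

omit [InnerProductSpace ℝ E] [FiniteDimensional ℝ E] [MeasurableSpace E] [BorelSpace E] in
theorem lipschitzWith_min_one_infDist_smul [NormedSpace ℝ E] (S : Set E) (c : ℝ) :
    LipschitzWith ‖c‖₊ fun z : E => min 1 (Metric.infDist (c • z) S) := by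
  have h := ((Metric.lipschitz_infDist_pt S).comp (lipschitzWith_smul c)).const_min 1
  simpa using! h

/-- The expected truncated distance of `(r y + G) / r = y + G / r` to a set carrying `u` tends to
zero as `r` grows. -/
theorem tendsto_integral_min_one_infDist {S : Set E} (huS : ∀ᵐ y ∂u, y ∈ S) :
    Tendsto (fun n : ℕ => ∫ p,
      min 1 (Metric.infDist (((n : ℝ) + 1)⁻¹ • (((n : ℝ) + 1) • p.1 + p.2)) S)
      ∂u.prod (gaussianWeight E)) atTop (𝓝 0) := by
  have h := tendsto_integral_of_dominated_convergence (μ := u.prod (gaussianWeight E))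
    (F := fun (n : ℕ) p =>
      min 1 (Metric.infDist (((n : ℝ) + 1)⁻¹ • (((n : ℝ) + 1) • p.1 + p.2)) S))
    (f := fun _ => 0) (fun _ => 1)
    (fun n => ((lipschitzWith_min_one_infDist_smul S _).continuous.comp
      (by fun_prop)).aestronglyMeasurable) (integrable_const _)
    (fun n => ae_of_all _ fun p => by
      rw [Real.norm_of_nonneg (le_min zero_le_one Metric.infDist_nonneg)]
      exact min_le_left _ _) ?_
  · simpa using h
  · filter_upwards [Measure.quasiMeasurePreserving_fst.ae huS] with p hp
    refine squeeze_zero (fun n => le_min zero_le_one Metric.infDist_nonneg)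
      (g := fun n : ℕ => ((n : ℝ) + 1)⁻¹ * ‖p.2‖) (fun n => ?_) ?_
    · have hn : (0 : ℝ) < n + 1 := by positivity
      refine (min_le_right _ _).trans ((Metric.infDist_le_dist_of_mem hp).trans_eq ?_)
      rw [smul_add, smul_smul, inv_mul_cancel₀ hn.ne', one_smul, dist_eq_norm, add_sub_cancel_left,
        norm_smul, Real.norm_of_nonneg (inv_pos.2 hn).le]
    · have := (tendsto_one_div_add_atTop_nhds_zero_nat (𝕜 := ℝ)).mul_const ‖p.2‖
      simpa using this

/-- By Fatou's lemma, almost every trajectory comes, after rescaling, arbitrarily close to a set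
carrying `u` at arbitrarily late times. -/
theorem ae_exists_infDist_flow_lt (hu : ∀ᵐ y ∂u, ‖y‖ ≤ ρ) {S : Set E} (huS : ∀ᵐ y ∂u, y ∈ S)
    (s : ℝ) : ∀ᵐ z : E, ∀ ε > 0, ∀ N : ℕ, ∃ n ≥ N,
      Metric.infDist (((n : ℝ) + 1)⁻¹ •
        (isBoundedField_posteriorMean hu).flow s (n + 1) z) S < ε := by
  set hV := isBoundedField_posteriorMean hu
  set φ : ℕ → E → ℝ := fun n z =>
    min 1 (Metric.infDist (((n : ℝ) + 1)⁻¹ • hV.flow s (n + 1) z) S) with hφ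
  have hφ0 : ∀ n z, 0 ≤ φ n z := fun n z => le_min zero_le_one Metric.infDist_nonneg
  have hφc : ∀ n, Continuous (φ n) := fun n =>
    (lipschitzWith_min_one_infDist_smul S _).continuous.comp (hV.continuous_flow s _)
  have hint : Tendsto (fun n => ∫ p, φ n (s • p.1 + p.2) ∂u.prod (gaussianWeight E)) atTop
      (𝓝 0) := by
    refine (tendsto_integral_min_one_infDist huS).congr fun n => ?_
    refine (integral_flow_eq hu (lipschitzWith_min_one_infDist_smul S ((n : ℝ) + 1)⁻¹) (C := 1)
      (fun z => ?_) s (n + 1)).symm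
    rw [Real.norm_of_nonneg (le_min zero_le_one Metric.infDist_nonneg)]
    exact min_le_left _ _
  have hzm : Measurable fun p : E × E => s • p.1 + p.2 := by fun_prop
  have hmeas : ∀ n, Measurable fun p : E × E => ENNReal.ofReal (φ n (s • p.1 + p.2)) := fun n =>
    ((hφc n).measurable.comp hzm).ennreal_ofReal
  have hlint : ∫⁻ p, liminf (fun n => ENNReal.ofReal (φ n (s • p.1 + p.2))) atTop
      ∂u.prod (gaussianWeight E) = 0 := by
    refine le_antisymm ((lintegral_liminf_le hmeas).trans ?_) zero_le
    have h2 : Tendsto (fun n => ∫⁻ p, ENNReal.ofReal (φ n (s • p.1 + p.2))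
        ∂u.prod (gaussianWeight E)) atTop (𝓝 0) := by
      have := ENNReal.tendsto_ofReal hint
      rw [ENNReal.ofReal_zero] at this
      refine this.congr fun n => ?_
      refine ofReal_integral_eq_lintegral_ofReal (Integrable.of_bound
        ((hφc n).measurable.comp hzm).aestronglyMeasurable 1 (ae_of_all _ fun p => ?_))
        (ae_of_all _ fun p => hφ0 _ _)
      rw [Real.norm_of_nonneg (hφ0 _ _)]
      exact min_le_left _ _
    exact h2.liminf_eq.le
  rw [lintegral_eq_zero_iff (Measurable.liminf hmeas)] at hlint
  -- Fix one starting point `y`; the Gaussian and its translates have the same null sets.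
  obtain ⟨y, hy⟩ := (Measure.ae_ae_of_ae_prod hlint).exists
  have hz : ∀ᵐ z : E, liminf (fun n => ENNReal.ofReal (φ n z)) atTop = 0 :=
    (ae_add_left_iff (s • y)).1 (ae_gaussianWeight_iff.1 hy)
  filter_upwards [hz] with z hz ε hε N
  have hlt : liminf (fun n => ENNReal.ofReal (φ n z)) atTop < ENNReal.ofReal (min ε 1) := by
    rw [hz]; simpa using hε
  obtain ⟨n, hn, hnN⟩ := ((frequently_lt_of_liminf_lt (by isBoundedDefault) hlt).and_eventually
    (eventually_ge_atTop N)).exists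
  refine ⟨n, hnN, ?_⟩
  have h1 : φ n z < min ε 1 := (ENNReal.ofReal_lt_ofReal_iff (by positivity)).1 hn
  rcases min_lt_iff.1 (h1.trans_le le_rfl : min 1 _ < min ε 1) with h | h
  · exact absurd (h.trans_le (min_le_right _ _)) (lt_irrefl _)
  · exact h.trans_le (min_le_left _ _)

end Accumulation

/-! ### The score function and the change of coordinates -/

section Uniqueness

variable {E : Type*} [NormedAddCommGroup E] [NormedSpace ℝ E] {V : ℝ → E → E} {R : ℝ}

/-- Uniqueness forward in time when the differential equation is only known in the open interval. -/
theorem IsBoundedField.eq_of_hasDerivAt_Ioo (hV : IsBoundedField V R) {Y Y' : ℝ → E} {a b : ℝ}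
    (hab : a ≤ b) (hYc : ContinuousOn Y (Icc a b))
    (hY : ∀ r ∈ Ioo a b, HasDerivAt Y (V r (Y r)) r) (hY' : IsSolution V Y') (ha : Y a = Y' a) :
    Y b = Y' b := by
  rcases hab.eq_or_lt with rfl | hlt
  · exact ha
  obtain ⟨K, hK⟩ := hV.lipschitz (max |a| |b|)
  have ha' := (abs_le.1 (le_max_left |a| |b|)).1
  have hb' := (abs_le.1 (le_max_right |a| |b|)).2
  have hle : ∀ᶠ s in 𝓝[>] a, dist (Y b) (Y' b) ≤ dist (Y s) (Y' s) * Real.exp (K * (b - s)) := by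
    filter_upwards [Ioo_mem_nhdsGT hlt] with s hs
    have hsub : Icc s b ⊆ Icc a b := Icc_subset_Icc_left hs.1.le
    exact dist_le_of_lipschitzWith (fun q hq => hK q ⟨by linarith [(hsub hq).1],
      by linarith [hq.2]⟩) hs.2.le (hYc.mono hsub) hY'.continuous.continuousOn
      (fun q hq => (hY q ⟨hs.1.trans_le hq.1, hq.2⟩).hasDerivWithinAt)
      fun q _ => (hY' q).hasDerivWithinAt
  have hYlim : Tendsto Y (𝓝[>] a) (𝓝 (Y a)) :=
    ((hYc a (left_mem_Icc.2 hab)).mono_of_mem_nhdsWithin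
      (mem_of_superset (Ioo_mem_nhdsGT hlt) Ioo_subset_Icc_self)).tendsto
  have hlim : Tendsto (fun s => dist (Y s) (Y' s) * Real.exp (K * (b - s))) (𝓝[>] a)
      (𝓝 (dist (Y a) (Y' a) * Real.exp (K * (b - a)))) :=
    (hYlim.dist (hY'.continuous.continuousWithinAt.tendsto)).mul
      ((by fun_prop : Continuous fun s => Real.exp (K * (b - s))).continuousWithinAt.tendsto)
  rw [ha, dist_self, zero_mul] at hlim
  exact dist_le_zero.1 (ge_of_tendsto hlim hle)

end Uniqueness

section Score

variable {E : Type*} [NormedAddCommGroup E] [InnerProductSpace ℝ E] [FiniteDimensional ℝ E]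
  [MeasurableSpace E] [BorelSpace E] {u : Measure E} [IsProbabilityMeasure u] {ρ : ℝ}

theorem hasGradientAt_integral_gaussian (hu : ∀ᵐ y ∂u, ‖y‖ ≤ ρ) (r : ℝ) (x : E) :
    HasGradientAt (fun x => ∫ y, Real.exp (-‖r • x - r • y‖ ^ 2 / 4) ∂u)
      (-(r ^ 2 / 2) • (∫ y, Real.exp (-‖r • x - r • y‖ ^ 2 / 4) ∂u) •
        (x - posteriorMean u r (r • x))) x := by
  have hρ : 0 ≤ ρ := by
    obtain ⟨y, hy⟩ := hu.exists
    exact (norm_nonneg y).trans hy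
  have hd : ∀ x y : E, HasFDerivAt (fun x => Real.exp (-‖r • x - r • y‖ ^ 2 / 4))
      (innerSL ℝ ((r ^ 2 / 2) • Real.exp (-‖r • x - r • y‖ ^ 2 / 4) • (y - x))) x := by
    intro x y
    have h1 : HasFDerivAt (fun x : E => r • x - r • y) (r • ContinuousLinearMap.id ℝ E) x :=
      ((hasFDerivAt_id x).const_smul r).sub_const _
    have h2 := ((h1.norm_sq.neg).mul_const (1 / 4 : ℝ)).exp
    have e : (fun x : E => Real.exp (-‖r • x - r • y‖ ^ 2 * (1 / 4)))
        = fun x => Real.exp (-‖r • x - r • y‖ ^ 2 / 4) := by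
      funext x; congr 1; ring
    refine HasFDerivAt.congr_fderiv (by simpa [div_eq_mul_inv] using! h2) ?_
    ext v
    simp [div_eq_mul_inv]
    ring
  have key := hasFDerivAt_integral_of_dominated_of_fderiv_le (𝕜 := ℝ) (μ := u) (x₀ := x)
    (F := fun x y => Real.exp (-‖r • x - r • y‖ ^ 2 / 4))
    (F' := fun x y => innerSL ℝ ((r ^ 2 / 2) • Real.exp (-‖r • x - r • y‖ ^ 2 / 4) • (y - x)))
    (bound := fun _ => r ^ 2 / 2 * (1 * (ρ + (‖x‖ + 1)))) (Metric.ball_mem_nhds x one_pos)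
    (Eventually.of_forall fun x => (integrable_gaussian r (r • x)).aestronglyMeasurable)
    (integrable_gaussian r (r • x)) (by fun_prop) ?_ (integrable_const _)
    (ae_of_all _ fun y x _ => hd x y)
  · rw [hasGradientAt_iff_hasFDerivAt]
    refine key.congr_fderiv ?_
    have hi : Integrable (fun y => (r ^ 2 / 2) •
        Real.exp (-‖r • x - r • y‖ ^ 2 / 4) • (y - x)) u :=
      (integrable_gaussian_smul_sub hu r (r • x) x).smul _
    rw [(innerSL ℝ).integral_comp_comm hi, integral_smul,
      ← integral_gaussian_smul_posteriorMean_sub hu]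
    have e (I : ℝ) (m : E) : (r ^ 2 / 2) • I • (m - x) = -(r ^ 2 / 2) • I • (x - m) := by module
    rw [e]
    rfl
  · filter_upwards [hu] with y hy x' hx'
    rw [innerSL_apply_norm, norm_smul, norm_smul, Real.norm_of_nonneg (by positivity),
      Real.norm_of_nonneg (Real.exp_pos _).le]
    have hx1 : ‖x'‖ ≤ ‖x‖ + 1 := by
      rw [Metric.mem_ball, dist_eq_norm] at hx'
      have := norm_sub_norm_le x' x
      linarith
    gcongr
    · exact exp_neg_sq_div_le_one _
    · exact (norm_sub_le _ _).trans (by linarith)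

end Score

section ReverseFlow

variable {d : ℕ} {u : Measure (EuclideanSpace ℝ (Fin d))} [IsProbabilityMeasure u] {ρ : ℝ}

/-- Tweedie's formula: the score points from `x` to the posterior mean. -/
theorem score_eq (hu : ∀ᵐ y ∂u, ‖y‖ ≤ ρ) (x : EuclideanSpace ℝ (Fin d)) {t : ℝ} (ht : 0 < t) :
    score u x t = -((√t)⁻¹ ^ 2 / 2) • (x - posteriorMean u (√t)⁻¹ ((√t)⁻¹ • x)) := by
  set r := (√t)⁻¹ with hr
  have hr2 : r ^ 2 = t⁻¹ := by rw [hr, inv_pow, Real.sq_sqrt ht.le]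
  set c : ℝ := (4 * Real.pi * t) ^ (-(d : ℝ) / 2) with hc
  have hc0 : c ≠ 0 := (Real.rpow_pos_of_pos (by positivity) _).ne'
  have hflow : ∀ z, heatFlow u z t = c * ∫ y, Real.exp (-‖r • z - r • y‖ ^ 2 / 4) ∂u := by
    intro z
    rw [heatFlow, ← integral_const_mul]
    congr 1
    funext y
    rw [heatKernel, ← smul_sub, norm_smul, mul_pow, Real.norm_eq_abs, sq_abs, hr2]
    congr 2
    field_simp
  have hI : ∫ y, Real.exp (-‖r • x - r • y‖ ^ 2 / 4) ∂u ≠ 0 :=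
    (integral_exp_pos (integrable_gaussian r (r • x))).ne'
  have hg := hasGradientAt_integral_gaussian hu r x
  rw [hasGradientAt_iff_hasFDerivAt] at hg
  have hlog := (hg.const_mul c).log (mul_ne_zero hc0 hI)
  have : HasGradientAt (fun z => Real.log (heatFlow u z t))
      (-(r ^ 2 / 2) • (x - posteriorMean u r (r • x))) x := by
    rw [hasGradientAt_iff_hasFDerivAt]
    simp_rw [hflow]
    refine hlog.congr_fderiv ?_
    rw [smul_comm (-(r ^ 2 / 2)), map_smul, smul_smul, smul_smul, mul_assoc,
      inv_mul_cancel₀ (mul_ne_zero hc0 hI), one_smul]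
  exact this.gradient

theorem hasDerivAt_inv_sqrt {t : ℝ} (ht : 0 < t) :
    HasDerivAt (fun t => (√t)⁻¹) (-((√t)⁻¹ ^ 3 / 2)) t := by
  have hs : √t ≠ 0 := (Real.sqrt_pos.2 ht).ne'
  refine ((Real.hasDerivAt_sqrt ht.ne').fun_inv hs).congr_deriv ?_
  field_simp

/-- The substitution `X_t = √t Y_{1/√t}` turns solutions of `Y' = 𝔼[y | r y + G = Y]` into solutions
of the reverse-time equation. -/
theorem hasDerivAt_sqrt_smul (hu : ∀ᵐ y ∂u, ‖y‖ ≤ ρ) {Y : ℝ → EuclideanSpace ℝ (Fin d)}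
    (hY : IsSolution (posteriorMean u) Y) {t : ℝ} (ht : 0 < t) :
    HasDerivAt (fun t => √t • Y (√t)⁻¹) (-score u (√t • Y (√t)⁻¹) t) t := by
  have hs : √t ≠ 0 := (Real.sqrt_pos.2 ht).ne'
  refine ((Real.hasDerivAt_sqrt ht.ne').fun_smul ((hY _).scomp t
    (hasDerivAt_inv_sqrt ht))).congr_deriv ?_
  rw [score_eq hu _ ht, smul_smul (√t)⁻¹, inv_mul_cancel₀ hs, one_smul, Function.comp_apply]
  simp only [smul_sub, smul_smul, neg_smul, neg_mul, smul_neg, sub_neg_eq_add]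
  rw [← sub_eq_zero]
  have e1 : (√t)⁻¹ ^ 2 / 2 * √t = 1 / (2 * √t) := by field_simp
  have e2 : √t * ((√t)⁻¹ ^ 3 / 2) = (√t)⁻¹ ^ 2 / 2 := by field_simp
  rw [e1, e2]
  module

/-- The inverse substitution `Y_r = r X_{1/r²}`. -/
theorem hasDerivAt_smul_inv_sq (hu : ∀ᵐ y ∂u, ‖y‖ ≤ ρ) {X : ℝ → EuclideanSpace ℝ (Fin d)} {r : ℝ}
    (hr : 0 < r) (hX : HasDerivAt X (-score u (X (r ^ 2)⁻¹) (r ^ 2)⁻¹) (r ^ 2)⁻¹) :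
    HasDerivAt (fun r => r • X (r ^ 2)⁻¹) (posteriorMean u r (r • X (r ^ 2)⁻¹)) r := by
  have h1 : HasDerivAt (fun r : ℝ => (r ^ 2)⁻¹) (-(2 * r) / (r ^ 2) ^ 2) r := by
    simpa using (hasDerivAt_pow 2 r).fun_inv (by positivity)
  refine ((hasDerivAt_id r).fun_smul (hX.scomp r h1)).congr_deriv ?_
  have hsq : (√(r ^ 2)⁻¹)⁻¹ = r := by rw [Real.sqrt_inv, Real.sqrt_sq hr.le, inv_inv]
  rw [score_eq hu _ (by positivity), hsq]
  simp only [id, Function.comp_apply, neg_smul, neg_neg, one_smul, smul_smul]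
  have e : r * (-(2 * r) / (r ^ 2) ^ 2 * (r ^ 2 / 2)) = -1 := by field_simp
  rw [e]
  module

variable {T : ℝ} {x_T : EuclideanSpace ℝ (Fin d)}

theorem isReverseFlow_flow (hu : ∀ᵐ y ∂u, ‖y‖ ≤ ρ) (hT : 0 < T) :
    IsReverseFlow u T x_T (fun t => √t •
      (isBoundedField_posteriorMean hu).flow (√T)⁻¹ (√t)⁻¹ ((√T)⁻¹ • x_T)) := by
  have hsol := (isBoundedField_posteriorMean hu).isSolution_flow (√T)⁻¹ ((√T)⁻¹ • x_T)
  refine ⟨fun t ht => ?_, fun t ht => hasDerivAt_sqrt_smul hu hsol ht.1, ?_⟩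
  · exact (hasDerivAt_sqrt_smul hu hsol ht.1).continuousAt.continuousWithinAt
  · have hs : √T ≠ 0 := (Real.sqrt_pos.2 hT).ne'
    simp only [IsBoundedField.flow_self]
    rw [smul_smul, mul_inv_cancel₀ hs, one_smul]

theorem IsReverseFlow.eq_flow (hu : ∀ᵐ y ∂u, ‖y‖ ≤ ρ) (hT : 0 < T)
    {X : ℝ → EuclideanSpace ℝ (Fin d)} (hX : IsReverseFlow u T x_T X) {t : ℝ} (ht : t ∈ Ioc 0 T) :
    X t = √t • (isBoundedField_posteriorMean hu).flow (√T)⁻¹ (√t)⁻¹ ((√T)⁻¹ • x_T) := by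
  have hst : 0 < √t := Real.sqrt_pos.2 ht.1
  have hsT : 0 < √T := Real.sqrt_pos.2 hT
  have hinv : ∀ {s : ℝ}, 0 < s → (((√s)⁻¹) ^ 2)⁻¹ = s := fun hs => by
    rw [inv_pow, inv_inv, Real.sq_sqrt hs.le]
  have hr0 : 0 < (√T)⁻¹ := inv_pos.2 hsT
  have hmem : ∀ r, (√T)⁻¹ ≤ r → (r ^ 2)⁻¹ ∈ Ioc 0 T := fun r hr => by
    have hr' := hr0.trans_le hr
    refine ⟨by positivity, ?_⟩
    calc (r ^ 2)⁻¹ ≤ (((√T)⁻¹) ^ 2)⁻¹ := by gcongr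
      _ = T := hinv hT
  have key := (isBoundedField_posteriorMean hu).eq_of_hasDerivAt_Ioo
    (Y := fun r => r • X (r ^ 2)⁻¹) (a := (√T)⁻¹) (b := (√t)⁻¹)
    (inv_anti₀ hst (Real.sqrt_le_sqrt ht.2))
    (continuousOn_id.smul (hX.continuousOn.comp (ContinuousOn.inv₀ (by fun_prop) fun r hr =>
      (pow_pos (hr0.trans_le hr.1) 2).ne') fun r hr => hmem r hr.1))
    (fun r hr => ?_)
    ((isBoundedField_posteriorMean hu).isSolution_flow (√T)⁻¹ ((√T)⁻¹ • x_T)) ?_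
  · simp only [hinv ht.1] at key
    rw [← key, smul_smul, mul_inv_cancel₀ hst.ne', one_smul]
  · have hr' := hr0.trans hr.1
    refine hasDerivAt_smul_inv_sq hu hr' (hX.hasDerivAt _ ⟨by positivity, ?_⟩)
    calc (r ^ 2)⁻¹ < (((√T)⁻¹) ^ 2)⁻¹ := by gcongr; exact hr.1
      _ = T := hinv hT
  · simp only [hinv hT, hX.terminal, IsBoundedField.flow_self]

end ReverseFlow

section Solutions

variable {E : Type*} [NormedAddCommGroup E] [InnerProductSpace ℝ E] [FiniteDimensional ℝ E]
  [MeasurableSpace E] [BorelSpace E] {u : Measure E} [IsProbabilityMeasure u] {ρ : ℝ}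

/-! ### Attraction to a convex set carrying the measure -/

/-- The increment of a solution is the time increment times a point of `K`, so the displacement from
`r • K` does not grow. -/
theorem infDist_inv_smul_le (hu : ∀ᵐ y ∂u, ‖y‖ ≤ ρ) {K : Set E} (hK : Convex ℝ K)
    (hKc : IsClosed K) (huK : ∀ᵐ y ∂u, y ∈ K) {Y : ℝ → E} (hY : IsSolution (posteriorMean u) Y)
    {s r : ℝ} (hs : 0 < s) (hsr : s ≤ r) {p : E} (hp : p ∈ K) :
    Metric.infDist (r⁻¹ • Y r) K ≤ r⁻¹ * ‖Y s - s • p‖ := by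
  have hr : 0 < r := hs.trans_le hsr
  obtain ⟨q, hq, hYq⟩ : ∃ q ∈ K, Y r - Y s = (r - s) • q := by
    rcases hsr.eq_or_lt with rfl | hlt
    · exact ⟨p, hp, by simp⟩
    have hc : Continuous fun v => posteriorMean u v (Y v) :=
      (isBoundedField_posteriorMean hu).continuous_along hY.continuous
    have hint := intervalIntegral.integral_eq_sub_of_hasDerivAt (a := s) (b := r)
      (fun v _ => hY v) (hc.intervalIntegrable _ _)
    refine ⟨⨍ v in Ioc s r, posteriorMean u v (Y v), ?_, ?_⟩
    · refine hK.set_average_mem hKc (by simp [hlt]) (by simp)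
        (ae_of_all _ fun v => posteriorMean_mem hu hK hKc huK v _) ?_
      exact (hc.integrableOn_Icc).mono_set Ioc_subset_Icc_self
    · rw [← hint, intervalIntegral.integral_of_le hsr, setAverage_eq, smul_smul,
        Real.volume_real_Ioc_of_le hsr, mul_inv_cancel₀ (sub_pos.2 hlt).ne', one_smul]
  have hmem : (s / r) • p + ((r - s) / r) • q ∈ K :=
    hK hp hq (by positivity) (div_nonneg (sub_nonneg.2 hsr) hr.le) (by field_simp; ring)
  refine (Metric.infDist_le_dist_of_mem hmem).trans_eq ?_
  rw [dist_eq_norm, ← Real.norm_of_nonneg (inv_pos.2 hr).le, ← norm_smul]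
  congr 1
  rw [Real.norm_of_nonneg (inv_pos.2 hr).le, sub_eq_iff_eq_add.1 hYq]
  simp only [div_eq_inv_mul, mul_smul, smul_sub, smul_add]
  abel

/-! ### Trapping near an isolated atom -/

/-- Near the ray `r a` of an isolated atom `a`, the posterior mean is super-exponentially close
to `a`. -/
theorem norm_posteriorMean_sub_atom_le (hu : ∀ᵐ y ∂u, ‖y‖ ≤ ρ) {a : E} (ha : u {a} ≠ 0) {D : ℝ}
    (hD : 0 < D) (hsep : ∀ᵐ y ∂u, y = a ∨ D ≤ ‖y - a‖) {r : ℝ} (hr : 0 < r) {z : E}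
    (hz : ‖z - r • a‖ ≤ D / 4 * r) :
    ‖posteriorMean u r z - a‖ ≤ (ρ + ‖a‖) / u.real {a} * Real.exp (-(D ^ 2 * r ^ 2 / 8)) := by
  have hρ : 0 ≤ ρ := by
    obtain ⟨y, hy⟩ := hu.exists
    exact (norm_nonneg y).trans hy
  have hα : 0 < u.real {a} := by
    rw [Measure.real]; exact ENNReal.toReal_pos ha (measure_ne_top _ _)
  set I := ∫ y, Real.exp (-‖z - r • y‖ ^ 2 / 4) ∂u with hI
  have hIlow : u.real {a} * Real.exp (-(D / 4 * r) ^ 2 / 4) ≤ I := by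
    calc u.real {a} * Real.exp (-(D / 4 * r) ^ 2 / 4)
        ≤ u.real {a} * Real.exp (-‖z - r • a‖ ^ 2 / 4) := by gcongr
      _ = ∫ y in {a}, Real.exp (-‖z - r • y‖ ^ 2 / 4) ∂u := by simp [Measure.real]
      _ ≤ I := setIntegral_le_integral (integrable_gaussian r z)
          (ae_of_all _ fun _ => (Real.exp_pos _).le)
  have hIpos : 0 < I := lt_of_lt_of_le (by positivity) hIlow
  have hup : ‖∫ y, Real.exp (-‖z - r • y‖ ^ 2 / 4) • (y - a) ∂u‖
      ≤ Real.exp (-(3 * D / 4 * r) ^ 2 / 4) * (ρ + ‖a‖) := by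
    refine (norm_integral_le_of_norm_le_const ?_).trans_eq (by rw [probReal_univ, mul_one])
    filter_upwards [hu, hsep] with y hy hya
    rcases hya with rfl | hya
    · simp only [sub_self, smul_zero, norm_zero]
      positivity
    · rw [norm_smul, Real.norm_eq_abs, Real.abs_exp]
      have h1 : 3 * D / 4 * r ≤ ‖z - r • y‖ := by
        have h2 : ‖r • (y - a)‖ ≤ ‖z - r • a‖ + ‖z - r • y‖ := by
          have : r • (y - a) = (z - r • a) - (z - r • y) := by module
          rw [this]; exact norm_sub_le _ _
        rw [norm_smul, Real.norm_of_nonneg hr.le] at h2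
        nlinarith
      have h3 : ‖y - a‖ ≤ ρ + ‖a‖ := (norm_sub_le _ _).trans (by linarith)
      gcongr
  rw [← integral_gaussian_smul_posteriorMean_sub hu, norm_smul, Real.norm_of_nonneg hIpos.le] at hup
  have h4 : u.real {a} * Real.exp (-(D / 4 * r) ^ 2 / 4) * ‖posteriorMean u r z - a‖
      ≤ Real.exp (-(3 * D / 4 * r) ^ 2 / 4) * (ρ + ‖a‖) :=
    (mul_le_mul_of_nonneg_right hIlow (norm_nonneg _)).trans hup
  have h5 : Real.exp (-(3 * D / 4 * r) ^ 2 / 4)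
      = Real.exp (-(D / 4 * r) ^ 2 / 4) * Real.exp (-(D ^ 2 * r ^ 2 / 8)) := by
    rw [← Real.exp_add]; congr 1; ring
  rw [h5] at h4
  have h6 : Real.exp (-(D / 4 * r) ^ 2 / 4) * (u.real {a} * ‖posteriorMean u r z - a‖)
      ≤ Real.exp (-(D / 4 * r) ^ 2 / 4) * (Real.exp (-(D ^ 2 * r ^ 2 / 8)) * (ρ + ‖a‖)) := by
    linarith
  have h7 := le_of_mul_le_mul_left h6 (Real.exp_pos _)
  rw [div_mul_eq_mul_div, le_div_iff₀ hα]
  linarith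

/-- A solution that is close to the ray `r a` of an isolated atom at a late enough time stays at
bounded distance from it. The first fencing argument shows that the solution never leaves the cone
`‖Y r - r a‖ ≤ D r / 4`; inside it the speed of `Y r - r a` is integrable. -/
theorem exists_trapping_time (hu : ∀ᵐ y ∂u, ‖y‖ ≤ ρ) {a : E} (ha : u {a} ≠ 0) {D : ℝ}
    (hD : 0 < D) (hsep : ∀ᵐ y ∂u, y = a ∨ D ≤ ‖y - a‖) :
    ∃ r₀ : ℝ, ∀ r₁ ≥ r₀, ∀ Y : ℝ → E, IsSolution (posteriorMean u) Y →
      ‖Y r₁ - r₁ • a‖ ≤ D / 4 * r₁ → ∃ C, ∀ r ≥ r₁, ‖Y r - r • a‖ ≤ C := by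
  have hρ : 0 ≤ ρ := by
    obtain ⟨y, hy⟩ := hu.exists
    exact (norm_nonneg y).trans hy
  set B := (ρ + ‖a‖) / u.real {a} with hB
  have hB0 : 0 ≤ B := div_nonneg (by positivity) measureReal_nonneg
  set c := 8 * B / D ^ 2 with hc
  have hc0 : 0 ≤ c := by positivity
  have hspeed : ∀ r > 0, ∀ z, ‖z - r • a‖ ≤ D / 4 * r → ‖posteriorMean u r z - a‖ ≤ c / r ^ 2 := by
    intro r hr z hz
    refine (norm_posteriorMean_sub_atom_le hu ha hD hsep hr hz).trans ?_
    have h1 : Real.exp (-(D ^ 2 * r ^ 2 / 8)) ≤ (D ^ 2 * r ^ 2 / 8)⁻¹ := by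
      rw [Real.exp_neg]
      exact inv_anti₀ (by positivity) (by linarith [Real.add_one_le_exp (D ^ 2 * r ^ 2 / 8)])
    calc B * Real.exp (-(D ^ 2 * r ^ 2 / 8)) ≤ B * (D ^ 2 * r ^ 2 / 8)⁻¹ := by gcongr
      _ = c / r ^ 2 := by rw [hc]; field_simp
  -- After this time the speed bound `c / r²` lies below the opening rate `D / 4` of the cone.
  refine ⟨4 * c / D + 1, fun r₁ hr₁ Y hY hYr₁ => ?_⟩
  have h1 : 1 ≤ r₁ := by
    have : 0 ≤ 4 * c / D := by positivity
    linarith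
  have hdZ : ∀ r, HasDerivAt (fun r => Y r - r • a) (posteriorMean u r (Y r) - a) r := fun r => by
    simpa using! (hY r).sub ((hasDerivAt_id r).smul_const a)
  have hcZ : Continuous fun r => Y r - r • a :=
    continuous_iff_continuousAt.2 fun r => (hdZ r).continuousAt
  have hcone : ∀ r ≥ r₁, ‖Y r - r • a‖ ≤ D / 4 * r := by
    intro r hr
    refine image_norm_le_of_norm_deriv_right_lt_deriv_boundary (B := fun r => D / 4 * r)
      (B' := fun _ => D / 4) hcZ.continuousOn (fun x _ => (hdZ x).hasDerivWithinAt) hYr₁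
      (fun x => by simpa using (hasDerivAt_id x).const_mul (D / 4)) (fun x hx hxe => ?_)
      (right_mem_Icc.2 hr)
    have hx1 : 1 ≤ x := h1.trans hx.1
    refine (hspeed x (by linarith) _ hxe.le).trans_lt ?_
    have h2 : 4 * c / D + 1 ≤ x ^ 2 := by nlinarith [hx.1]
    rw [div_lt_iff₀ (by positivity)]
    calc c = D / 4 * (4 * c / D) := by field_simp
      _ < D / 4 * x ^ 2 := by gcongr; linarith
  refine ⟨‖Y r₁ - r₁ • a‖ + c, fun r hr => ?_⟩
  have h3 := image_norm_le_of_norm_deriv_right_le_deriv_boundary' (a := r₁) (b := r)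
    (f := fun r => Y r - r • a)
    (B := fun r => ‖Y r₁ - r₁ • a‖ + c * (1 / r₁ - 1 / r)) (B' := fun r => c / r ^ 2)
    hcZ.continuousOn (fun x _ => (hdZ x).hasDerivWithinAt) (by simp)
    (fun x hx => ContinuousAt.continuousWithinAt (by
      have : x ≠ 0 := by linarith [hx.1]
      fun_prop (disch := assumption)))
    (fun x hx => by
      have hx0 : x ≠ 0 := by linarith [hx.1]
      refine HasDerivAt.hasDerivWithinAt ?_
      simp only [one_div]
      refine ((((hasDerivAt_inv hx0).const_sub r₁⁻¹).const_mul c).const_add _).congr_deriv ?_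
      field_simp)
    (fun x hx => hspeed x (by linarith [hx.1]) _ (hcone x hx.1)) (right_mem_Icc.2 hr)
  refine h3.trans ?_
  have h4 : 1 / r₁ ≤ 1 := by rw [div_le_one (by linarith)]; exact h1
  have hr0 : 0 < r := by linarith
  have h5 : 0 ≤ 1 / r := by positivity
  gcongr
  nlinarith

end Solutions

/-! ### Limits of the reverse flow -/

section Limits

variable {d : ℕ} {u : Measure (EuclideanSpace ℝ (Fin d))} [IsProbabilityMeasure u] {ρ : ℝ} {T : ℝ}

theorem ae_smul_of_ae {p : EuclideanSpace ℝ (Fin d) → Prop} (h : ∀ᵐ z, p z) {c : ℝ} (hc : c ≠ 0) :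
    ∀ᵐ x : EuclideanSpace ℝ (Fin d), p (c • x) := by
  rw [ae_iff] at h ⊢
  have := Measure.addHaar_preimage_smul (volume : Measure (EuclideanSpace ℝ (Fin d))) hc {z | ¬p z}
  rw [h, mul_zero] at this
  exact this

/-- Almost every reverse trajectory visits each neighbourhood of a set carrying `u` at arbitrarily
small times. -/
theorem ae_forall_exists_infDist_lt (hu : ∀ᵐ y ∂u, ‖y‖ ≤ ρ) (hT : 0 < T)
    {S : Set (EuclideanSpace ℝ (Fin d))} (huS : ∀ᵐ y ∂u, y ∈ S) :
    ∀ᵐ x_T : EuclideanSpace ℝ (Fin d), ∀ X, IsReverseFlow u T x_T X →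
      ∀ ε > 0, ∀ δ > 0, ∃ t ∈ Ioc 0 T, t < δ ∧ Metric.infDist (X t) S < ε := by
  have hsT : (√T)⁻¹ ≠ 0 := (inv_pos.2 (Real.sqrt_pos.2 hT)).ne'
  filter_upwards [ae_smul_of_ae (ae_exists_infDist_flow_lt hu huS (√T)⁻¹) hsT]
    with x hx X hX ε hε δ hδ
  obtain ⟨N, hN⟩ := exists_nat_gt (min T δ)⁻¹
  obtain ⟨n, hn, hlt⟩ := hx ε hε N
  have hn1 : (0 : ℝ) < n + 1 := by positivity
  have hmin : 0 < min T δ := lt_min hT hδ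
  -- The time `t = (n + 1)⁻²` corresponds to `r = n + 1`.
  have ht : (((n : ℝ) + 1) ^ 2)⁻¹ < min T δ := by
    rw [inv_lt_comm₀ (by positivity) hmin]
    have : (N : ℝ) ≤ n := Nat.cast_le.2 hn
    nlinarith
  have hsq : √(((n : ℝ) + 1) ^ 2)⁻¹ = ((n : ℝ) + 1)⁻¹ := by rw [Real.sqrt_inv, Real.sqrt_sq hn1.le]
  have hmem : (((n : ℝ) + 1) ^ 2)⁻¹ ∈ Ioc 0 T :=
    ⟨by positivity, ht.le.trans (min_le_left _ _)⟩
  refine ⟨_, hmem, ht.trans_le (min_le_right _ _), ?_⟩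
  rw [hX.eq_flow hu hT hmem, hsq, inv_inv]
  exact hlt

/-- Outside a null set, the reverse flow of a finite combination of point masses converges to one of
them at rate `√t`. -/
theorem ae_exists_tendsto_atom (hu : ∀ᵐ y ∂u, ‖y‖ ≤ ρ) (hT : 0 < T) {ι : Type*} [Finite ι]
    {y : ι → EuclideanSpace ℝ (Fin d)} (hy : ∀ k, u {y k} ≠ 0) (huy : ∀ᵐ x ∂u, x ∈ range y) :
    ∀ᵐ x_T : EuclideanSpace ℝ (Fin d), ∀ X, IsReverseFlow u T x_T X →
      ∃ i, Tendsto X (𝓝[>] (0 : ℝ)) (𝓝 (y i)) ∧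
        ∃ C : ℝ, 0 < C ∧ ∀ t ∈ Ioc 0 T, ‖X t - y i‖ ≤ C * √t := by
  -- `D` is a lower bound for the distance between distinct atoms.
  obtain ⟨D, hDsep, hD⟩ : ∃ D : ℝ, (∀ i k, y k = y i ∨ D ≤ ‖y k - y i‖) ∧ 0 < D := by
    have hev : ∀ i k, ∀ᶠ D in 𝓝[>] (0 : ℝ), y k = y i ∨ D ≤ ‖y k - y i‖ := fun i k => by
      by_cases h : y k = y i
      · exact Eventually.of_forall fun _ => Or.inl h
      · filter_upwards [Ioo_mem_nhdsGT (norm_pos_iff.2 (sub_ne_zero.2 h))] with D hD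
        exact Or.inr hD.2.le
    exact ((eventually_all.2 fun i => eventually_all.2 (hev i)).and self_mem_nhdsWithin).exists
  have hsep : ∀ i, ∀ᵐ x ∂u, x = y i ∨ D ≤ ‖x - y i‖ := fun i => by
    filter_upwards [huy] with x hx
    obtain ⟨k, rfl⟩ := hx
    exact hDsep i k
  choose r₀ hr₀ using fun i => exists_trapping_time hu (hy i) hD (hsep i)
  obtain ⟨R, hR, hR0⟩ : ∃ R : ℝ, (∀ i, r₀ i ≤ R) ∧ 0 < R :=
    ((eventually_all.2 fun i => eventually_ge_atTop (r₀ i)).and (eventually_gt_atTop 0)).exists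
  filter_upwards [ae_forall_exists_infDist_lt hu hT huy] with x hx X hX
  obtain ⟨t₁, ht₁, ht₁R, hdist⟩ := hx X hX (D / 4) (by positivity) (R ^ 2)⁻¹ (by positivity)
  have hne : (range y).Nonempty := by
    obtain ⟨z, hz⟩ := huy.exists
    exact ⟨z, hz⟩
  obtain ⟨_, ⟨i, rfl⟩, hi⟩ := (Metric.infDist_lt_iff hne).1 hdist
  set Y := ((isBoundedField_posteriorMean hu).flow (√T)⁻¹ · ((√T)⁻¹ • x)) with hYdef
  have hY : IsSolution (posteriorMean u) Y := (isBoundedField_posteriorMean hu).isSolution_flow _ _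
  have hXY : ∀ t ∈ Ioc 0 T, X t = √t • Y (√t)⁻¹ := fun t ht => hX.eq_flow hu hT ht
  have hst₁ : 0 < √t₁ := Real.sqrt_pos.2 ht₁.1
  have hR1 : R ≤ (√t₁)⁻¹ := by
    rw [le_inv_comm₀ hR0 hst₁]
    have := Real.sqrt_le_sqrt ht₁R.le
    rwa [Real.sqrt_inv, Real.sqrt_sq hR0.le] at this
  obtain ⟨C₁, hC₁⟩ := hr₀ i (√t₁)⁻¹ ((hR i).trans hR1) Y hY (by
    rw [dist_eq_norm, hXY t₁ ht₁] at hi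
    have e : Y (√t₁)⁻¹ - (√t₁)⁻¹ • y i = (√t₁)⁻¹ • (√t₁ • Y (√t₁)⁻¹ - y i) := by
      rw [smul_sub, smul_smul, inv_mul_cancel₀ hst₁.ne', one_smul]
    rw [e, norm_smul, Real.norm_of_nonneg (inv_pos.2 hst₁).le, mul_comm]
    gcongr)
  obtain ⟨C₂, hC₂⟩ := (isCompact_Icc (a := (√T)⁻¹) (b := (√t₁)⁻¹)).exists_bound_of_continuousOn
    (f := fun r => Y r - r • y i)
    (hY.continuous.sub (continuous_id.smul continuous_const)).continuousOn
  have hbound : ∀ t ∈ Ioc 0 T, ‖X t - y i‖ ≤ (max (max C₁ C₂) 1) * √t := by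
    intro t ht
    have hst : 0 < √t := Real.sqrt_pos.2 ht.1
    have e : X t - y i = √t • (Y (√t)⁻¹ - (√t)⁻¹ • y i) := by
      rw [hXY t ht, smul_sub, smul_smul, mul_inv_cancel₀ hst.ne', one_smul]
    rw [e, norm_smul, Real.norm_of_nonneg hst.le, mul_comm]
    gcongr
    rcases le_total (√t₁)⁻¹ (√t)⁻¹ with h | h
    · exact (hC₁ _ h).trans ((le_max_left _ _).trans (le_max_left _ _))
    · exact (hC₂ _ ⟨inv_anti₀ hst (Real.sqrt_le_sqrt ht.2), h⟩).trans
        ((le_max_right _ _).trans (le_max_left _ _))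
  refine ⟨i, tendsto_iff_norm_sub_tendsto_zero.2 ?_, max (max C₁ C₂) 1,
    lt_max_of_lt_right one_pos, hbound⟩
  refine squeeze_zero' (Eventually.of_forall fun _ => norm_nonneg _)
    (g := fun t => max (max C₁ C₂) 1 * √t) ?_ ?_
  · filter_upwards [Ioc_mem_nhdsGT hT] with t ht using hbound t ht
  · have : Continuous fun t : ℝ => max (max C₁ C₂) 1 * √t := by fun_prop
    simpa using this.continuousWithinAt (s := Ioi 0) (x := 0) |>.tendsto

end Limits

theorem mainTheorem3 (d : ℕ) (u₀ : Measure (EuclideanSpace ℝ (Fin d)))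
    [IsProbabilityMeasure u₀] (hu₀ : IsCompact u₀.support) (T : ℝ) (hT : 0 < T) :
    -- well-posedness: for every terminal point there is exactly one trajectory on `(0, T]`
    (∀ x_T : EuclideanSpace ℝ (Fin d),
      (∃ X : ℝ → EuclideanSpace ℝ (Fin d), IsReverseFlow u₀ T x_T X) ∧
      ∀ X Y : ℝ → EuclideanSpace ℝ (Fin d),
        IsReverseFlow u₀ T x_T X → IsReverseFlow u₀ T x_T Y → EqOn X Y (Ioc 0 T)) ∧
    -- (i)
    (∀ᵐ x_T : EuclideanSpace ℝ (Fin d) ∂volume,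
      ∀ X : ℝ → EuclideanSpace ℝ (Fin d), IsReverseFlow u₀ T x_T X →
        liminf (fun t => Metric.infEDist (X t) u₀.support) (𝓝[>] (0 : ℝ)) = 0) ∧
    -- (ii)
    (∀ x_T : EuclideanSpace ℝ (Fin d),
      ∀ X : ℝ → EuclideanSpace ℝ (Fin d), IsReverseFlow u₀ T x_T X →
        ∀ t ∈ Ioc 0 T,
          Metric.infDist (X t) (convexHull ℝ u₀.support) ≤
            Metric.infDist x_T (convexHull ℝ u₀.support) * T ^ (-(1 / 2) : ℝ) * √t) ∧
    -- (iii)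
    (∀ (N : ℕ) (w : Fin N → ℝ) (y : Fin N → EuclideanSpace ℝ (Fin d)),
      (∀ k, 0 < w k) →
      u₀ = ∑ k, ENNReal.ofReal (w k) • Measure.dirac (y k) →
      ∀ᵐ x_T : EuclideanSpace ℝ (Fin d) ∂volume,
        ∀ X : ℝ → EuclideanSpace ℝ (Fin d), IsReverseFlow u₀ T x_T X →
          ∃ i : Fin N, Tendsto X (𝓝[>] (0 : ℝ)) (𝓝 (y i)) ∧
            ∃ C : ℝ, 0 < C ∧ ∀ t ∈ Ioc 0 T, ‖X t - y i‖ ≤ C * √t) := by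
  have huS : ∀ᵐ y ∂u₀, y ∈ u₀.support := Measure.support_mem_ae
  have hne : u₀.support.Nonempty := Measure.nonempty_support (IsProbabilityMeasure.ne_zero u₀)
  obtain ⟨ρ, hρ⟩ := hu₀.isBounded.exists_norm_le
  have hu : ∀ᵐ y ∂u₀, ‖y‖ ≤ ρ := huS.mono hρ
  refine ⟨fun x_T => ⟨⟨_, isReverseFlow_flow hu hT⟩, fun X Y hX hY t ht => ?_⟩, ?_, ?_, ?_⟩
  · rw [hX.eq_flow hu hT ht, hY.eq_flow hu hT ht]
  · filter_upwards [ae_forall_exists_infDist_lt hu hT huS] with x_T hx X hX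
    refine le_antisymm (le_of_forall_gt fun c hc => ?_) zero_le
    obtain ⟨ε, hε, hεc⟩ := ENNReal.lt_iff_exists_nnreal_btwn.1 hc
    refine lt_of_le_of_lt (liminf_le_of_frequently_le' ?_) hεc
    rw [(nhdsGT_basis (0 : ℝ)).frequently_iff]
    intro δ hδ
    obtain ⟨t, ht, htδ, hlt⟩ := hx X hX ε (by exact_mod_cast hε) δ hδ
    refine ⟨t, ⟨ht.1, htδ⟩, ?_⟩
    rw [← ENNReal.ofReal_coe_nnreal]
    exact (ENNReal.le_ofReal_iff_toReal_le (Metric.infEDist_ne_top hne) ε.2).2 hlt.le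
  · intro x_T X hX t ht
    have hst : 0 < √t := Real.sqrt_pos.2 ht.1
    have hsT : 0 < √T := Real.sqrt_pos.2 hT
    -- Passing to the closure does not change distances and makes the hull compact.
    rw [← Metric.infDist_closure (s := convexHull ℝ u₀.support),
      ← Metric.infDist_closure (s := convexHull ℝ u₀.support)]
    set K := closure (convexHull ℝ u₀.support)
    have hK : IsCompact K := (isBounded_convexHull.2 hu₀.isBounded).isCompact_closure
    obtain ⟨p, hp, hpd⟩ := hK.exists_infDist_eq_dist hne.convexHull.closure x_T
    have h := infDist_inv_smul_le hu (convex_convexHull ℝ u₀.support).closure hK.isClosed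
      (huS.mono fun _ hy => subset_closure (subset_convexHull ℝ _ hy))
      ((isBoundedField_posteriorMean hu).isSolution_flow (√T)⁻¹ ((√T)⁻¹ • x_T))
      (inv_pos.2 hsT) (inv_anti₀ hst (Real.sqrt_le_sqrt ht.2)) hp
    rw [inv_inv, ← hX.eq_flow hu hT ht, IsBoundedField.flow_self, ← smul_sub, norm_smul,
      Real.norm_of_nonneg (inv_pos.2 hsT).le, ← dist_eq_norm, ← hpd] at h
    rw [Real.rpow_neg hT.le, ← Real.sqrt_eq_rpow]
    linarith
  · intro N w y hw hsum
    refine ae_exists_tendsto_atom hu hT (fun k => ?_) ?_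
    · have hle : ENNReal.ofReal (w k) • Measure.dirac (y k) ≤ u₀ := by
        rw [hsum]
        exact Finset.single_le_sum (f := fun k => ENNReal.ofReal (w k) • Measure.dirac (y k))
          (fun _ _ => Measure.zero_le _) (Finset.mem_univ k)
      have := hle {y k}
      simp only [Measure.smul_apply, smul_eq_mul, Measure.dirac_apply_of_mem (mem_singleton (y k)),
        mul_one] at this
      exact ((ENNReal.ofReal_pos.2 (hw k)).trans_le this).ne'
    · rw [hsum, ae_iff]
      simp
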